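/- Let $\mathbb{N}=\{1,2,\dots\}$, let $[n]=\{1,\dots,n\}$ (with $[0]=\emptyset$), let $S_n$ be the set of permutations of $[n]$, and let $S_\infty$ be the set of permutations $\sigma=\sigma_1\sigma_2\cdots$ of $\mathbb{N}$, with the $\sigma$-algebra generated by the maps $\sigma\mapsto\sigma_i$. For a probability distribution $p=\{p_j\}_{j=1}^\infty$ on $\mathbb{N}$ with $p_j>0$ for all $j$, let $n_1,n_2,\dots$ be independent samples from $p$, and set $\Pi_1=n_1$ and, for $k\ge2$, $\Pi_k=\psi_k(n_k)$, where $\psi_k$ is the increasing bijection from $\mathbb{N}$ to $\mathbb{N}-\{\Pi_1,\dots,\Pi_{k-1}\}$. Almost surely $\Pi=\Pi_1\Pi_2\cdots\in S_\infty$; its law on $S_\infty$ is called the $p$-shifted distribution. For $\sigma\in S_\infty$: the backward rank $I_{<j}(\sigma)$, $j\ge2$, is the number of $i<j$ that appear to the right of $j$ in $\sigma$, i.e. $I_{<j}(\sigma)=\#\{i<j:\sigma^{-1}_i>\sigma^{-1}_j\}$; $\mathrm{proj}_n(\sigma)\in S_n$ is obtained from $\sigma$ by deleting all $\sigma_i$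 with $\sigma_i>n$; and $\sigma$ has a renewal at $n$ if $\sigma([n])=[n]$. A random permutation $\Pi$ of $\mathbb{N}$ is strictly regenerative if almost surely there are $0=T_0<T_1<T_2<\cdots$ such that $\{T_1,T_2,\dots\}$ is exactly the set of $n\ge1$ at which $\Pi$ has a renewal, and such that the gaps $T_k-T_{k-1}$, $k\ge1$, are IID and the reduced permutations of the restrictions of $\Pi$ to $[T_k]-[T_{k-1}]$, $k\ge1$, are IID. Here the reduced permutation of a permutation $\pi=\pi_{a+1}\cdots\pi_{a+m}$ of $\{a+1,\dots,a+m\}$ is the element $\mathrm{red}(\pi)\in S_m$ with $\mathrm{red}(\pi)_i=\pi_{a+i}-a$. Its renewal mechanism is positive recurrent if $E\,T_1<\infty$. Proposition. The class of $p$-shifted distributions, as $p$ runs over all probability distributions $\{p_j\}_{j=1}^\infty$ whose supports are all of $\mathbb{N}$ and that satisfy $\sum_{n=1}^\infty np_n<\infty$, coincides with the class of probability distributions $P$ on $S_\infty$ that satisfy the following three conditions: (i) the backward ranks $\{I_{<j}\}_{j=2}^\infty$ are independent under $P$; (ii) a random permutation under $P$ is strictly regenerative with a positive recurrent renewal mechanism,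 and the probability $u_1$ of renewal at the number $1$ is positive; (iii) for all $n\in\mathbb{N}$, the support of $P_n(\cdot):=P(\mathrm{proj}_n^{-1}(\cdot))$ is all of $S_n$. -/

import Mathlib

open MeasureTheory ProbabilityTheory

/-!  Indexing convention: the positive integers `{1, 2, 3, …}` are represented by Lean's
`ℕ = {0, 1, 2, …}`, the Lean number `k` standing for the positive integer `k + 1`, both for
positions and for values. Thus `[n] = {1, …, n}` is `Set.Iio n`, the group of permutations of `[n]`
is `Equiv.Perm (Fin n)`, and a distribution `p₁, p₂, …` on the positive integers is a
`p : PMF ℕ` with `p k = p_{k+1}`. Sizes and renewal numbers are not shifted. -/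

namespace PShifted

noncomputable section

/-- Permutations of the positive integers. -/
abbrev SInf : Type := Equiv.Perm ℕ

/-- The σ-algebra on `SInf` generated by the coordinate maps `σ ↦ σ_i`. -/
instance : MeasurableSpace SInf :=
  ⨆ i : ℕ, MeasurableSpace.comap (fun σ : SInf => σ i) ⊤

/-- Given samples `s`, the sequence `Π_k = ψ_k(s_k)`, where `ψ_k` is the increasing bijection from
the positive integers onto those not in `{Π_i : i < k}`. -/
def shiftedSeq (s : ℕ → ℕ) (k : ℕ) : ℕ :=
  Nat.nth (fun m => ∀ i : Fin k, shiftedSeq s i ≠ m) (s k)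
termination_by k
decreasing_by exact i.isLt

open Classical in
/-- The sequence `shiftedSeq s` as a permutation. (It is always injective, and for independent
samples from a `p` with `p₁ > 0` it is almost surely onto; on the remaining null set the value is
arbitrary.) -/
def shiftedPerm (s : ℕ → ℕ) : SInf :=
  if h : Function.Bijective (shiftedSeq s) then Equiv.ofBijective (shiftedSeq s) h else 1

/-- The `p`-shifted distribution: the law of `shiftedPerm` for independent samples from `p`. -/
def pShifted (p : PMF ℕ) : Measure SInf :=
  (Measure.infinitePi (fun _ : ℕ => p.toMeasure)).map shiftedPerm

/-- The backward rank `I_{<j}(σ)`: how many smaller numbers stand to the right of the number `j`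
in `σ`. -/
def backwardRank (j : ℕ) (σ : SInf) : ℕ :=
  ((Finset.range j).filter (fun i => σ.symm j < σ.symm i)).card

theorem setOf_lt_finite (σ : SInf) (n : ℕ) : (Set.ofPred fun k => σ k < n).Finite :=
  Set.Finite.preimage σ.injective.injOn (Set.finite_Iio n)

theorem card_setOf_lt (σ : SInf) (n : ℕ) : (setOf_lt_finite σ n).toFinset.card = n := by
  have h : (setOf_lt_finite σ n).toFinset = (Finset.range n).map σ.symm.toEmbedding := by
    ext k
    simp
  rw [h, Finset.card_map, Finset.card_range]

/-- The `i`-th entry of the word `σ₁ σ₂ …` after deletion of all entries exceeding `n`. -/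
def projFun (n : ℕ) (σ : SInf) (i : Fin n) : Fin n :=
  ⟨σ (Nat.nth (fun k => σ k < n) i), Nat.nth_mem (p := fun k => σ k < n) i
    (fun _ => lt_of_lt_of_eq i.isLt (card_setOf_lt σ n).symm)⟩

theorem projFun_bijective (n : ℕ) (σ : SInf) : Function.Bijective (projFun n σ) := by
  refine Finite.injective_iff_bijective.mp fun i j h => ?_
  have h1 := σ.injective (congrArg Fin.val h)
  have h2 := Nat.nth_injOn (setOf_lt_finite σ n)
    (by rw [card_setOf_lt]; exact i.isLt) (by rw [card_setOf_lt]; exact j.isLt) h1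
  exact Fin.ext h2

/-- `proj_n(σ)`, the permutation of `[n]` obtained from `σ` by deleting all entries exceeding `n`.
-/
def proj (n : ℕ) (σ : SInf) : Equiv.Perm (Fin n) :=
  Equiv.ofBijective (projFun n σ) (projFun_bijective n σ)

/-- `σ` has a renewal at `n`: `σ([n]) = [n]`. (True at `n = 0`.) -/
def IsRenewal (σ : SInf) (n : ℕ) : Prop :=
  σ '' Set.Iio n = Set.Iio n

/-- The renewal numbers `0 = T_0 < T_1 < T_2 < ⋯`, i.e. the increasing enumeration of the `m ≥ 0`
with `σ([m]) = [m]`. (If there are only finitely many, the missing ones have the value `0`.) -/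
def renewalTime (k : ℕ) (σ : SInf) : ℕ :=
  Nat.nth (IsRenewal σ) k

/-- Permutations of `[m]`, of any finite size `m`. -/
def FinPerm : Type := Σ m : ℕ, Equiv.Perm (Fin m)

instance : MeasurableSpace FinPerm := ⊤

theorem IsRenewal.apply_lt_iff {σ : SInf} {n : ℕ} (h : IsRenewal σ n) (k : ℕ) :
    σ k < n ↔ k < n := by
  have h1 : σ k ∈ σ '' Set.Iio n ↔ σ k ∈ Set.Iio n := by rw [h]
  simpa using h1.symm

/-- For renewals `a`, `b` of `σ`, the restriction of `σ` to `[b] - [a]`, with `a` subtracted from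
the positions and from the values. -/
def redFun {σ : SInf} {a b : ℕ} (ha : IsRenewal σ a) (hb : IsRenewal σ b) (i : Fin (b - a)) :
    Fin (b - a) :=
  ⟨σ (a + i) - a, by
    have h1 := (hb.apply_lt_iff (a + i)).2 (by omega)
    have h2 := ha.apply_lt_iff (a + i)
    omega⟩

theorem redFun_bijective {σ : SInf} {a b : ℕ} (ha : IsRenewal σ a) (hb : IsRenewal σ b) :
    Function.Bijective (redFun ha hb) := by
  refine Finite.injective_iff_bijective.mp fun i j h => ?_
  have h0 : σ (a + i) - a = σ (a + j) - a := congrArg Fin.val h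
  have h1 := ha.apply_lt_iff (a + i)
  have h2 := ha.apply_lt_iff (a + j)
  have h3 : σ (a + i) = σ (a + j) := by omega
  have h4 := σ.injective h3
  exact Fin.ext (by omega)

open Classical in
/-- The reduced permutation of the restriction of `σ` to `[b] - [a]`, when `a` and `b` are renewals
of `σ` (otherwise an arbitrary value). -/
def red (σ : SInf) (a b : ℕ) : FinPerm :=
  ⟨b - a, if h : IsRenewal σ a ∧ IsRenewal σ b then
    Equiv.ofBijective (redFun h.1 h.2) (redFun_bijective h.1 h.2) else 1⟩

/-- The `(k+1)`-st renewal gap `T_{k+1} - T_k`. -/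
def gap (k : ℕ) (σ : SInf) : ℕ :=
  renewalTime (k + 1) σ - renewalTime k σ

/-- The reduced permutation of the restriction of `σ` to `[T_{k+1}] - [T_k]`. -/
def block (k : ℕ) (σ : SInf) : FinPerm :=
  red σ (renewalTime k σ) (renewalTime (k + 1) σ)

/-- A sequence of random variables is IID under `P`. -/
def IID {Ω E : Type*} [MeasurableSpace Ω] [MeasurableSpace E] (X : ℕ → Ω → E) (P : Measure Ω) :
    Prop :=
  iIndepFun X P ∧ ∀ k, IdentDistrib (X k) (X 0) P P

/-- A random permutation with law `P` is strictly regenerative: almost surely there are infinitely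
many renewals `T_1 < T_2 < ⋯`, the gaps are IID and the reduced permutations between successive
renewals are IID. -/
def StrictlyRegenerative (P : Measure SInf) : Prop :=
  (∀ᵐ σ ∂P, {m : ℕ | IsRenewal σ m}.Infinite) ∧ IID gap P ∧ IID block P

/-- The renewal mechanism is positive recurrent: `E T_1 < ∞`. -/
def PositiveRecurrent (P : Measure SInf) : Prop :=
  ∫⁻ σ, (renewalTime 1 σ : ENNReal) ∂P < ⊤

/-- The probability `u_n` of a renewal at `n`. -/
def renewalProb (P : Measure SInf) (n : ℕ) : ENNReal :=
  P {σ | IsRenewal σ n}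

end

end PShifted

namespace PShifted

/-! Everything is indexed from zero; put F_j = p_0 + ⋯ + p_j (`cdfSum`). For the forward inclusion,
remove the first sample v. What remains is the permutation built from the shifted samples,
relabelled by the increasing map `skip v` that omits v (`shiftedSeq_succ`). Hence a renewal at n+1
means v ≤ n together with a renewal at n of the shifted samples, and the renewal probabilities are
u_n = F_0 ⋯ F_{n-1} (`sampleLaw_seqRenewal`). The construction restarts after a renewal, which makes
the blocks IID. The mean of p and the mean of T_1 are finite together
(`tsum_add_one_mul_lt_top_iff`): by the renewal equation for the nonincreasing u, E T_1 is finite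
exactly when inf u_n > 0, and the product of the F_j is bounded below exactly when ∑ (1 - F_j) is
finite. Conditioning the backward ranks on the first sample gives P(I_j = a_j for j < n) · ∏ F_j = ∏
p_{a_j} 1(a_j ≤ j) (`sampleLaw_rankEvent_mul`). So the ranks are independent, I_j having the law p
truncated to {0, …, j}. Conversely, a renewal at 1 is the intersection of the independent events
I_{l+1} ≠ l+1, and given it the tail has law P again. Comparing these two facts, I_{j+1} conditioned
on I_{j+1} ≠ j+1 has the law of I_j (`measure_backwardRank_succ`). This recursion, with u_1 = ∏
P(I_{l+1} ≠ l+1) > 0, exhibits all rank laws as truncations of a single p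
(`exists_pmf_of_recursion`). The ranks generate the σ-algebra, so P is the p-shifted law, and
positive recurrence returns the finite mean. -/

/-! ### Discrete sequences and infinite product measures -/

/-- The sequence `s` with its first `m` terms removed. -/
def shift {E : Type*} (m : ℕ) (s : ℕ → E) (i : ℕ) : E := s (m + i)

theorem measurable_shift {E : Type*} [MeasurableSpace E] (m : ℕ) :
    Measurable (shift m : (ℕ → E) → ℕ → E) :=
  measurable_pi_lambda _ fun _ => measurable_pi_apply _

/-- Every set in the discrete codomain is measurable, and `A` is the preimage of its image. The
σ-algebra on `Ω` is an ordinary implicit argument so that sub-σ-algebras can be supplied. -/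
theorem measurableSet_of_factor {Ω T : Type*} {m : MeasurableSpace Ω} [MeasurableSpace T]
    [DiscreteMeasurableSpace T] {R : Ω → T} (hR : Measurable R) {A : Set Ω}
    (h : ∀ x y, R x = R y → x ∈ A → y ∈ A) : MeasurableSet A := by
  have : A = R ⁻¹' (R '' A) := by
    ext y
    exact ⟨fun hy => ⟨y, hy, rfl⟩, fun ⟨x, hx, hxy⟩ => h x y hxy hx⟩
  rw [this]
  exact hR (MeasurableSet.of_discrete)

theorem measurable_of_factor {Ω T α : Type*} {m : MeasurableSpace Ω} [MeasurableSpace T]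
    [DiscreteMeasurableSpace T] [MeasurableSpace α] {R : Ω → T} (hR : Measurable R) {f : Ω → α}
    (h : ∀ x y, R x = R y → f x = f y) : Measurable f := fun B _ =>
  measurableSet_of_factor hR fun x y hxy hx => by
    rw [Set.mem_preimage] at hx ⊢
    rwa [← h x y hxy]

theorem measurableSet_of_initial {E : Type*} [Countable E] [MeasurableSpace E] [MeasurableSingletonClass E]
    (n : ℕ) {A : Set (ℕ → E)}
    (h : ∀ s t : ℕ → E, (∀ i < n, s i = t i) → s ∈ A → t ∈ A) : MeasurableSet A :=
  measurableSet_of_factor (R := fun (s : ℕ → E) (i : Fin n) => s i) (by fun_prop)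
    fun s t hst => h s t fun i hi => congrFun hst ⟨i, hi⟩

theorem measurable_of_initial {E : Type*} [Countable E] [MeasurableSpace E] [MeasurableSingletonClass E]
    {α : Type*} [MeasurableSpace α] (n : ℕ) {f : (ℕ → E) → α}
    (h : ∀ s t : ℕ → E, (∀ i < n, s i = t i) → f s = f t) : Measurable f :=
  measurable_of_factor (R := fun (s : ℕ → E) (i : Fin n) => s i) (by fun_prop)
    fun s t hst => h s t fun i hi => congrFun hst ⟨i, hi⟩

theorem map_shift_infinitePi {E : Type*} [MeasurableSpace E] (ν : Measure E)
    [IsProbabilityMeasure ν] (m : ℕ) :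
    (Measure.infinitePi fun _ : ℕ => ν).map (shift m) = Measure.infinitePi fun _ : ℕ => ν :=
  Measure.map_infinitePi_infinitePi_of_inj (P := fun _ : ℕ => ν) (f := fun i => m + i)
    (add_right_injective m)

/-- The first `m` terms of an IID sequence are independent of the later ones. -/
theorem infinitePi_inter_shift {E : Type*} [Countable E] [MeasurableSpace E] [MeasurableSingletonClass E]
    (ν : Measure E) [IsProbabilityMeasure ν] (m : ℕ)
    {A B : Set (ℕ → E)} (hA : ∀ s t : ℕ → E, (∀ i < m, s i = t i) → s ∈ A → t ∈ A)
    (hB : MeasurableSet B) :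
    Measure.infinitePi (fun _ : ℕ => ν) (A ∩ shift m ⁻¹' B) =
      Measure.infinitePi (fun _ : ℕ => ν) A * Measure.infinitePi (fun _ : ℕ => ν) B := by
  have hind := iIndepFun_infinitePi (P := fun _ : ℕ => ν) (X := fun _ x => x)
    (fun _ => measurable_id)
  have h := indep_iSup_of_disjoint (fun i => (measurable_pi_apply i).comap_le) hind
    (S := Set.Iio m) (T := Set.Ici m) (Set.Iio_disjoint_Ici le_rfl)
  rw [Indep_iff] at h
  rw [h A (shift m ⁻¹' B)]
  · congr 1
    rw [← Measure.map_apply (measurable_shift m) hB, map_shift_infinitePi]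
  · refine @measurableSet_of_factor (ℕ → E) (Fin m → E) (_) _ _ (fun s i => s i) ?_ A
      fun s t hst => hA s t fun i hi => congrFun hst ⟨i, hi⟩
    refine @measurable_pi_lambda _ _ _ (_) _ _ fun i => ?_
    exact (comap_measurable (fun s : ℕ → E => s i)).mono
      (le_iSup₂_of_le (i : ℕ) i.isLt le_rfl) le_rfl
  · have : @Measurable _ _ (⨆ i ∈ Set.Ici m,
        MeasurableSpace.comap (fun s : ℕ → E => s i) inferInstance) _
        (shift m : (ℕ → E) → ℕ → E) := by
      refine @measurable_pi_lambda _ _ _ (_) _ _ fun i => ?_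
      exact (comap_measurable (fun s : ℕ → E => s (m + i))).mono
        (le_iSup₂_of_le (m + i) (Nat.le_add_right m i) le_rfl) le_rfl
    exact this hB

theorem infinitePi_first_inter_shift {E : Type*} [Countable E] [MeasurableSpace E] [MeasurableSingletonClass E]
    (ν : Measure E) [IsProbabilityMeasure ν] (v : E)
    {B : Set (ℕ → E)} (hB : MeasurableSet B) :
    Measure.infinitePi (fun _ : ℕ => ν) ({s | s 0 = v} ∩ shift 1 ⁻¹' B) =
      ν {v} * Measure.infinitePi (fun _ : ℕ => ν) B := by
  rw [infinitePi_inter_shift ν 1 (A := {s | s 0 = v})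
    (fun s t h hs => (h 0 one_pos).symm.trans hs) hB]
  congr 1
  have := Measure.infinitePi_map_eval (μ := fun _ : ℕ => ν) 0
  conv_rhs => rw [← this]
  rw [Measure.map_apply (measurable_pi_apply 0) (measurableSet_singleton v)]
  rfl

theorem infinitePi_initial {E : Type*} [MeasurableSpace E] [MeasurableSingletonClass E]
    (ν : ℕ → Measure E) [∀ i, IsProbabilityMeasure (ν i)] (n : ℕ)
    (a : ℕ → E) :
    Measure.infinitePi ν {s | ∀ i < n, s i = a i} = ∏ i ∈ Finset.range n, ν i {a i} := by
  rw [← Measure.infinitePi_pi ν (fun i _ => measurableSet_singleton (a i))]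
  congr 1
  ext s
  simp [Set.mem_pi]

/-- A sequence of discrete random variables whose initial segments have product laws. -/
theorem map_eq_infinitePi {E : Type*} [Countable E] [MeasurableSpace E] [MeasurableSingletonClass E]
    {Ω : Type*} [MeasurableSpace Ω] {P : Measure Ω}
    [IsProbabilityMeasure P] {X : ℕ → Ω → E} (hX : ∀ i, Measurable (X i)) (ν : ℕ → Measure E)
    [∀ i, IsProbabilityMeasure (ν i)]
    (h : ∀ (n : ℕ) (a : ℕ → E),
      P {ω | ∀ i < n, X i ω = a i} = ∏ i ∈ Finset.range n, ν i {a i}) :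
    P.map (fun ω i => X i ω) = Measure.infinitePi ν := by
  have hXm : Measurable fun ω i => X i ω := measurable_pi_lambda _ hX
  have := Measure.isProbabilityMeasure_map (μ := P) hXm.aemeasurable
  have e0 : E := (nonempty_of_isProbabilityMeasure (ν 0)).some
  -- Both measures are projective limits of the same finite products, so singletons in finitely many
  -- coordinates decide.
  refine IsProjectiveLimit.unique (P := fun I : Finset ℕ => Measure.pi fun i : I => ν i) ?_
    (Measure.isProjectiveLimit_infinitePi ν)
  rw [isProjectiveLimit_nat_iff (isProjectiveMeasureFamily_pi ν)]
  intro n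
  refine Measure.ext_of_singleton fun a => ?_
  let b : ℕ → E := fun i => if hi : i ∈ Finset.Iic n then a ⟨i, hi⟩ else e0
  have hpre : (Preorder.frestrictLe n : (ℕ → E) → _) ⁻¹' {a} = {s | ∀ i < n + 1, s i = b i} := by
    ext s
    simp only [Set.mem_preimage, Set.mem_singleton_iff, funext_iff, Set.mem_ofPred_eq, b]
    constructor
    · intro hs i hi
      have hi' : i ∈ Finset.Iic n := by simpa using Nat.lt_succ_iff.mp hi
      rw [dif_pos hi']
      exact hs ⟨i, hi'⟩
    · rintro hs ⟨i, hi⟩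
      have := hs i (by simpa [Nat.lt_succ_iff] using hi)
      rw [dif_pos hi] at this
      exact this
  have hpi : _ = Measure.pi _ := Measure.isProjectiveLimit_infinitePi ν (Finset.Iic n)
  rw [← hpi, Measure.map_apply (Preorder.measurable_frestrictLe n) (measurableSet_singleton _),
    Measure.map_apply (Finset.measurable_restrict _) (measurableSet_singleton _)]
  change _ = Measure.infinitePi ν ((Preorder.frestrictLe n : (ℕ → E) → _) ⁻¹' {a})
  rw [hpre, infinitePi_initial]
  refine (Measure.map_apply hXm ?_).trans (h _ _)
  exact measurableSet_of_initial (n + 1) fun s t hst hs i hi => (hst i hi).symm.trans (hs i hi)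

theorem iIndepFun_of_map_eq_infinitePi {E : Type*} [MeasurableSpace E]
    {Ω : Type*} [MeasurableSpace Ω] {P : Measure Ω}
    [IsProbabilityMeasure P] {X : ℕ → Ω → E} (hX : ∀ i, Measurable (X i)) (ν : ℕ → Measure E)
    [∀ i, IsProbabilityMeasure (ν i)] (h : P.map (fun ω i => X i ω) = Measure.infinitePi ν) :
    iIndepFun X P ∧ ∀ i, P.map (X i) = ν i := by
  have hm : ∀ i, P.map (X i) = ν i := fun i => by
    rw [← Measure.infinitePi_map_eval (μ := ν) i, ← h,
      Measure.map_map (measurable_pi_apply i) (measurable_pi_lambda _ hX)]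
    rfl
  refine ⟨(iIndepFun_iff_map_fun_eq_infinitePi_map hX).2 ?_, hm⟩
  simp_rw [h, hm]

/-! ### The shifted sequence and its first-step recursion -/

/-- The increasing bijection from the natural numbers onto those different from `v`. -/
def skip (v x : ℕ) : ℕ := if x < v then x else x + 1

theorem strictMono_skip (v : ℕ) : StrictMono (skip v) := by
  intro x y hxy
  simp only [skip]
  split_ifs <;> omega

theorem skip_ne (v x : ℕ) : skip v x ≠ v := by
  simp only [skip]
  split_ifs <;> omega

theorem exists_skip_eq {v y : ℕ} (h : y ≠ v) : ∃ x, skip v x = y := by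
  simp only [skip]
  rcases lt_or_gt_of_ne h with h | h
  · exact ⟨y, if_pos h⟩
  · exact ⟨y - 1, by rw [if_neg (by omega)]; omega⟩

theorem skip_lt_succ_iff {v n x : ℕ} (hv : v ≤ n) : skip v x < n + 1 ↔ x < n := by
  simp only [skip]
  split_ifs <;> omega

theorem skip_of_le {v x : ℕ} (h : v ≤ x) : skip v x = x + 1 := if_neg (by omega)

theorem skip_of_lt {v x : ℕ} (h : x < v) : skip v x = x := if_pos h

theorem shiftedSeq_eq_nth (s : ℕ → ℕ) (k : ℕ) :
    shiftedSeq s k = Nat.nth (fun m => ∀ i < k, shiftedSeq s i ≠ m) (s k) := by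
  rw [shiftedSeq]
  congr 1
  ext m
  exact ⟨fun h i hi => h ⟨i, hi⟩, fun h i => h i i.isLt⟩

theorem infinite_unused (f : ℕ → ℕ) (k : ℕ) :
    (Set.ofPred fun m => ∀ i < k, f i ≠ m).Infinite := by
  have h : (f '' Set.Iio k).Finite := (Set.finite_Iio k).image f
  refine h.infinite_compl.mono fun m hm => ?_
  rw [Set.mem_ofPred_eq]
  exact fun i hi him => hm ⟨i, hi, him⟩

theorem shiftedSeq_ne (s : ℕ → ℕ) {i k : ℕ} (h : i < k) : shiftedSeq s i ≠ shiftedSeq s k := by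
  have := Nat.nth_mem_of_infinite (infinite_unused (shiftedSeq s) k) (s k)
  rw [← shiftedSeq_eq_nth] at this
  exact this i h

theorem shiftedSeq_injective (s : ℕ → ℕ) : Function.Injective (shiftedSeq s) := by
  intro i j h
  by_contra hij
  rcases lt_or_gt_of_ne hij with hlt | hlt
  · exact shiftedSeq_ne s hlt h
  · exact shiftedSeq_ne s hlt h.symm

theorem shiftedSeq_congr {s t : ℕ → ℕ} (k : ℕ) (h : ∀ i ≤ k, s i = t i) :
    shiftedSeq s k = shiftedSeq t k := by
  induction k using Nat.strong_induction_on with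
  | _ k ih =>
    rw [shiftedSeq_eq_nth, shiftedSeq_eq_nth, h k le_rfl]
    congr 1
    ext m
    refine forall₂_congr fun i hi => ?_
    rw [ih i hi fun j hj => h j (hj.trans hi.le)]

theorem shiftedSeq_zero (s : ℕ → ℕ) : shiftedSeq s 0 = s 0 := by
  rw [shiftedSeq_eq_nth]
  simp

/-- The numbers still available after the first choice are exactly the values of the increasing map
`skip (s 0)`, and `Nat.nth` commutes with such a relabelling. -/
theorem shiftedSeq_succ (s : ℕ → ℕ) (k : ℕ) :
    shiftedSeq s (k + 1) = skip (s 0) (shiftedSeq (shift 1 s) k) := by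
  induction k using Nat.strong_induction_on with
  | _ k ih =>
    rw [shiftedSeq_eq_nth, shiftedSeq_eq_nth (shift 1 s),
      ← Nat.nth_comp_of_strictMono (strictMono_skip (s 0))]
    · congr 1
      have hs : shift 1 s k = s (k + 1) := by rw [shift, add_comm]
      rw [hs]
      congr 1
      ext m
      constructor
      · intro h i hi hm
        refine h (i + 1) (by omega) ?_
        rw [ih i hi, hm]
      · intro h i hi
        rcases i with _ | i
        · rw [shiftedSeq_zero]
          exact (skip_ne _ _).symm
        · rw [ih i (by omega)]
          exact fun hm => h i (by omega) ((strictMono_skip _).injective hm)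
    · intro m hm
      have := hm 0 (by omega)
      rw [shiftedSeq_zero] at this
      exact exists_skip_eq this.symm
    · exact fun hfi => absurd hfi (infinite_unused _ _)

/-! ### Renewals of the shifted sequence -/

/-- The first `m` terms of `shiftedSeq s` are the first `m` natural numbers. -/
def SeqRenewal (s : ℕ → ℕ) (m : ℕ) : Prop := ∀ i < m, shiftedSeq s i < m

theorem SeqRenewal.exists_eq {s : ℕ → ℕ} {m : ℕ} (h : SeqRenewal s m) {v : ℕ} (hv : v < m) :
    ∃ i < m, shiftedSeq s i = v := by
  have := Finset.surj_on_of_inj_on_of_card_le (s := Finset.range m) (t := Finset.range m)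
    (fun i _ => shiftedSeq s i) (fun i hi => by simpa using h i (by simpa using hi))
    (fun _ _ _ _ hij => shiftedSeq_injective s hij) le_rfl v (by simpa using hv)
  obtain ⟨i, hi, hiv⟩ := this
  exact ⟨i, by simpa using hi, hiv.symm⟩

theorem SeqRenewal.le_apply {s : ℕ → ℕ} {m : ℕ} (h : SeqRenewal s m) {k : ℕ} (hk : m ≤ k) :
    m ≤ shiftedSeq s k := by
  by_contra hlt
  obtain ⟨i, hi, hik⟩ := h.exists_eq (not_le.1 hlt)
  have := shiftedSeq_injective s hik
  omega

/-- At a renewal the unused numbers are precisely those from `m` on, so the construction restarts,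
translated by `m`. -/
theorem SeqRenewal.shiftedSeq_add {s : ℕ → ℕ} {m : ℕ} (h : SeqRenewal s m) (k : ℕ) :
    shiftedSeq s (m + k) = m + shiftedSeq (shift m s) k := by
  induction k using Nat.strong_induction_on with
  | _ k ih =>
    rw [shiftedSeq_eq_nth, shiftedSeq_eq_nth (shift m s),
      ← Nat.nth_comp_of_strictMono (f := fun x => m + x) (fun x y hxy => by simpa using hxy)]
    · rw [shift]
      congr 2
      ext y
      constructor
      · intro h' i hi hm
        refine h' (m + i) (by omega) ?_
        rw [ih i hi, hm]
      · intro h' i hi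
        by_cases him : i < m
        · have := h i him
          omega
        · obtain ⟨j, rfl⟩ := Nat.exists_eq_add_of_le (not_lt.1 him)
          have := h' j (by omega)
          rw [ih j (by omega)]
          omega
    · intro y hy
      have : m ≤ y := by
        by_contra hlt
        obtain ⟨i, hi, hiy⟩ := h.exists_eq (not_le.1 hlt)
        exact hy i (by omega) hiy
      exact ⟨y - m, by simp only; omega⟩
    · exact fun hfi => absurd hfi (infinite_unused _ _)

theorem SeqRenewal.add_iff {s : ℕ → ℕ} {m : ℕ} (h : SeqRenewal s m) (n : ℕ) :
    SeqRenewal s (m + n) ↔ SeqRenewal (shift m s) n := by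
  constructor
  · intro h' i hi
    have := h' (m + i) (by omega)
    rw [h.shiftedSeq_add] at this
    omega
  · intro h' i hi
    by_cases him : i < m
    · have := h i him
      omega
    · obtain ⟨j, rfl⟩ := Nat.exists_eq_add_of_le (not_lt.1 him)
      have := h' j (by omega)
      rw [h.shiftedSeq_add]
      omega

theorem seqRenewal_zero (s : ℕ → ℕ) : SeqRenewal s 0 := fun i hi => absurd hi (Nat.not_lt_zero i)

/-- This is the source of the product formula for the renewal probabilities: for `v ≤ n`, `skip v`
sends exactly the numbers below `n` to numbers below `n + 1`. -/
theorem seqRenewal_succ_iff (s : ℕ → ℕ) (n : ℕ) :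
    SeqRenewal s (n + 1) ↔ s 0 < n + 1 ∧ SeqRenewal (shift 1 s) n := by
  constructor
  · intro h
    have h0 := h 0 (by omega)
    rw [shiftedSeq_zero] at h0
    refine ⟨h0, fun i hi => ?_⟩
    have := h (i + 1) (by omega)
    rwa [shiftedSeq_succ, skip_lt_succ_iff (by omega)] at this
  · rintro ⟨h0, h⟩ i hi
    rcases i with _ | i
    · rwa [shiftedSeq_zero]
    · rw [shiftedSeq_succ, skip_lt_succ_iff (by omega)]
      exact h i (by omega)

theorem SeqRenewal.congr {s t : ℕ → ℕ} {m : ℕ} (hst : ∀ i < m, s i = t i)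
    (h : SeqRenewal s m) : SeqRenewal t m := fun i hi => by
  rw [← shiftedSeq_congr i fun j hj => hst j (by omega)]
  exact h i hi

theorem measurableSet_seqRenewal (m : ℕ) : MeasurableSet {s | SeqRenewal s m} :=
  measurableSet_of_initial m fun _ _ hst h => SeqRenewal.congr hst h

/-! ### Bijectivity, and measurability on permutations -/

/-- A sample `0` picks the smallest unused number. If `v` were never used, all these picks would lie
below `v`, which injectivity permits only finitely often. -/
theorem shiftedSeq_surjective {s : ℕ → ℕ} (h : {k | s k = 0}.Infinite) :
    Function.Surjective (shiftedSeq s) := by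
  intro v
  by_contra hv
  push Not at hv
  refine h ((Set.Finite.preimage (shiftedSeq_injective s).injOn (Set.finite_Iio v)).subset ?_)
  intro k hk
  rw [Set.mem_preimage, Set.mem_Iio]
  refine lt_of_le_of_ne ?_ (hv k)
  have hk : s k = 0 := hk
  rw [shiftedSeq_eq_nth, hk, Nat.nth_zero]
  exact Nat.sInf_le fun i _ => hv i

/-- The sample needed at time `k` is the number of unused values below `f k`. -/
theorem exists_shiftedSeq_eq {f : ℕ → ℕ} (hf : Function.Injective f) :
    ∃ s, ∀ k, shiftedSeq s k = f k := by
  classical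
  refine ⟨fun k => Nat.count (fun m => ∀ i < k, f i ≠ m) (f k), fun k => ?_⟩
  induction k using Nat.strong_induction_on with
  | _ k ih =>
    rw [shiftedSeq_eq_nth]
    have : (fun m => ∀ i < k, shiftedSeq (fun k => Nat.count (fun m => ∀ i < k, f i ≠ m) (f k)) i
        ≠ m) = fun m => ∀ i < k, f i ≠ m := by
      ext m
      exact forall₂_congr fun i hi => by rw [ih i hi]
    rw [this]
    refine Nat.nth_count (p := fun m => ∀ i < k, f i ≠ m) fun i hi hik => ?_
    exact absurd (hf hik) hi.ne

theorem measurable_shiftedSeq_apply (k : ℕ) : Measurable fun s => shiftedSeq s k :=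
  measurable_of_initial (k + 1) fun _ _ h => shiftedSeq_congr k fun i hi => h i (by omega)

theorem measurableSet_bijective_shiftedSeq :
    MeasurableSet {s | Function.Bijective (shiftedSeq s)} := by
  have : {s | Function.Bijective (shiftedSeq s)} = ⋂ v, ⋃ k, {s | shiftedSeq s k = v} := by
    ext s
    simp [Function.Bijective, shiftedSeq_injective, Function.Surjective]
  rw [this]
  exact MeasurableSet.iInter fun v => MeasurableSet.iUnion fun k =>
    measurable_shiftedSeq_apply k (measurableSet_singleton v)

theorem shiftedPerm_apply {s : ℕ → ℕ} (h : Function.Bijective (shiftedSeq s)) (k : ℕ) :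
    shiftedPerm s k = shiftedSeq s k := by
  rw [shiftedPerm, dif_pos h]
  rfl

theorem measurable_sInf_apply (i : ℕ) : Measurable fun σ : SInf => σ i :=
  measurable_iff_comap_le.2 (le_iSup (fun i => MeasurableSpace.comap (fun σ : SInf => σ i) ⊤) i)

theorem measurable_sInf_iff {Ω : Type*} [MeasurableSpace Ω] {f : Ω → SInf} :
    Measurable f ↔ ∀ i, Measurable fun ω => f ω i := by
  constructor
  · exact fun h i => (measurable_sInf_apply i).comp h
  · intro h
    rw [measurable_iff_comap_le]
    change MeasurableSpace.comap f (⨆ i, _) ≤ _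
    rw [MeasurableSpace.comap_iSup]
    refine iSup_le fun i => ?_
    rw [MeasurableSpace.comap_comp]
    exact (h i).comap_le

theorem measurable_shiftedPerm : Measurable shiftedPerm := by
  classical
  refine measurable_sInf_iff.2 fun i => ?_
  have : (fun s => shiftedPerm s i) =
      fun s => if Function.Bijective (shiftedSeq s) then shiftedSeq s i else i := by
    ext s
    split_ifs with h
    · exact shiftedPerm_apply h i
    · rw [shiftedPerm, dif_neg h]
      rfl
  rw [this]
  exact Measurable.ite measurableSet_bijective_shiftedSeq (measurable_shiftedSeq_apply i)
    measurable_const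

theorem isRenewal_iff {σ : SInf} {n : ℕ} : IsRenewal σ n ↔ ∀ i < n, σ i < n := by
  refine ⟨fun h i hi => (h.apply_lt_iff i).2 hi, fun h => ?_⟩
  refine Set.eq_of_subset_of_ncard_le ?_ ?_ (Set.finite_Iio n)
  · rintro _ ⟨i, hi, rfl⟩
    exact h i hi
  · rw [Set.ncard_image_of_injective _ σ.injective]

theorem isRenewal_zero (σ : SInf) : IsRenewal σ 0 :=
  isRenewal_iff.2 fun i hi => absurd hi (Nat.not_lt_zero i)

theorem isRenewal_one_iff {σ : SInf} : IsRenewal σ 1 ↔ σ 0 = 0 := by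
  rw [isRenewal_iff]
  constructor
  · intro h
    have := h 0 one_pos
    omega
  · intro h i hi
    obtain rfl : i = 0 := by omega
    omega

theorem isRenewal_shiftedPerm_iff {s : ℕ → ℕ} (h : Function.Bijective (shiftedSeq s)) (m : ℕ) :
    IsRenewal (shiftedPerm s) m ↔ SeqRenewal s m := by
  rw [isRenewal_iff]
  exact forall₂_congr fun i _ => by rw [shiftedPerm_apply h]

theorem IsRenewal.symm_apply_lt_iff {σ : SInf} {n : ℕ} (h : IsRenewal σ n) (k : ℕ) :
    σ.symm k < n ↔ k < n := by
  rw [← h.apply_lt_iff (σ.symm k), Equiv.apply_symm_apply]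

theorem measurableSet_isRenewal (n : ℕ) : MeasurableSet {σ : SInf | IsRenewal σ n} := by
  have : {σ : SInf | IsRenewal σ n} = ⋂ i, ⋂ (_ : i < n), {σ : SInf | σ i < n} := by
    ext σ
    simp [isRenewal_iff]
  rw [this]
  exact MeasurableSet.iInter fun i => MeasurableSet.iInter fun _ =>
    measurable_sInf_apply i (measurableSet_Iio (a := n))

theorem measurable_sInf_symm_apply (j : ℕ) : Measurable fun σ : SInf => σ.symm j := by
  refine measurable_to_countable' fun i => ?_
  have : (fun σ : SInf => σ.symm j) ⁻¹' {i} = (fun σ : SInf => σ i) ⁻¹' {j} := by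
    ext σ
    simp only [Set.mem_preimage, Set.mem_singleton_iff]
    rw [Equiv.symm_apply_eq, eq_comm]
  rw [this]
  exact measurable_sInf_apply i (measurableSet_singleton j)

/-! ### Backward ranks and the σ-algebra they generate -/

theorem measurable_backwardRank (j : ℕ) : Measurable fun σ : SInf => backwardRank j σ := by
  refine measurable_of_factor (R := fun (σ : SInf) (i : Fin (j + 1)) => σ.symm i)
    (measurable_pi_lambda _ fun i => measurable_sInf_symm_apply i) fun σ τ h => ?_
  have h' : ∀ i ≤ j, σ.symm i = τ.symm i := fun i hi => congrFun h ⟨i, by omega⟩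
  unfold backwardRank
  congr 1
  refine Finset.filter_congr fun i hi => ?_
  rw [h' j le_rfl, h' i (Finset.mem_range.1 hi).le]

theorem backwardRank_le (j : ℕ) (σ : SInf) : backwardRank j σ ≤ j := by
  simpa using! Finset.card_filter_le (Finset.range j) (fun i => σ.symm j < σ.symm i)

theorem backwardRank_eq_self_iff {j : ℕ} {σ : SInf} :
    backwardRank j σ = j ↔ ∀ i < j, σ.symm j < σ.symm i := by
  have := Finset.card_filter_eq_iff (s := Finset.range j) (p := fun i => σ.symm j < σ.symm i)
  rw [Finset.card_range] at this
  rw [backwardRank, this]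
  simp

/-- A nonzero first entry precedes all smaller numbers and so has maximal rank, while `0` in front
prevents any other number from doing so. The renewal becomes an intersection of events involving one
rank each. -/
theorem isRenewal_one_iff_backwardRank {σ : SInf} :
    IsRenewal σ 1 ↔ ∀ l, backwardRank (l + 1) σ ≠ l + 1 := by
  rw [isRenewal_one_iff]
  constructor
  · intro h l hl
    have := backwardRank_eq_self_iff.1 hl 0 (by omega)
    rw [show σ.symm 0 = 0 by rw [Equiv.symm_apply_eq, h]] at this
    omega
  · intro h
    by_contra h0
    obtain ⟨l, hl⟩ := Nat.exists_eq_succ_of_ne_zero h0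
    refine h l (backwardRank_eq_self_iff.2 fun i hi => ?_)
    rw [show σ.symm (l + 1) = 0 by rw [Equiv.symm_apply_eq, hl]]
    refine Nat.pos_of_ne_zero fun hi0 => ?_
    rw [Equiv.symm_apply_eq, hl] at hi0
    omega

theorem backwardRank_first {σ : SInf} {v : ℕ} (h : σ 0 = v) : backwardRank v σ = v := by
  refine backwardRank_eq_self_iff.2 fun i hi => ?_
  rw [show σ.symm v = 0 by rw [Equiv.symm_apply_eq, h]]
  refine Nat.pos_of_ne_zero fun hi0 => ?_
  rw [Equiv.symm_apply_eq, h] at hi0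
  omega

/-- The relabelling preserves the order of values and of positions, and `v`, standing first, is
never to the right of anything. -/
theorem backwardRank_skip {σ τ : SInf} {v : ℕ} (h0 : σ 0 = v)
    (h : ∀ k, σ (k + 1) = skip v (τ k)) (x : ℕ) :
    backwardRank (skip v x) σ = backwardRank x τ := by
  have hs : ∀ y, σ.symm (skip v y) = τ.symm y + 1 := fun y => by
    rw [Equiv.symm_apply_eq, h, Equiv.apply_symm_apply]
  unfold backwardRank
  refine Eq.trans ?_ (Finset.card_map ⟨skip v, (strictMono_skip v).injective⟩)
  congr 1
  ext i
  simp only [Finset.mem_filter, Finset.mem_range, Finset.mem_map, Function.Embedding.coeFn_mk, hs]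
  constructor
  · rintro ⟨hi, hlt⟩
    have hiv : i ≠ v := by
      rintro rfl
      rw [show σ.symm i = 0 by rw [Equiv.symm_apply_eq, h0]] at hlt
      omega
    obtain ⟨y, rfl⟩ := exists_skip_eq hiv
    rw [hs] at hlt
    exact ⟨y, ⟨(strictMono_skip v).lt_iff_lt.1 hi, by omega⟩, rfl⟩
  · rintro ⟨y, ⟨hy, hlt⟩, rfl⟩
    rw [hs]
    exact ⟨strictMono_skip v hy, by omega⟩

/-- The numbers below `n` standing to the right of `n` form a final segment of their common order;
two final segments of equal size coincide. -/
theorem symm_lt_symm_of_backwardRank_eq {n : ℕ} {σ τ : SInf}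
    (ho : ∀ a < n, ∀ b < n, σ.symm a < σ.symm b ↔ τ.symm a < τ.symm b)
    (hr : backwardRank n σ = backwardRank n τ) {a : ℕ} (ha : a < n)
    (h : σ.symm n < σ.symm a) : τ.symm n < τ.symm a := by
  by_contra h'
  have hne : τ.symm a ≠ τ.symm n := fun he => ha.ne (τ.symm.injective he)
  have hlt : τ.symm a < τ.symm n := by omega
  have hss : (Finset.range n).filter (fun i => τ.symm n < τ.symm i) ⊂
      (Finset.range n).filter (fun i => σ.symm n < σ.symm i) := by
    rw [Finset.ssubset_iff_of_subset]
    · exact ⟨a, by simp [ha, h], by simp [h']⟩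
    · intro b hb
      simp only [Finset.mem_filter, Finset.mem_range] at hb ⊢
      exact ⟨hb.1, h.trans ((ho a ha b hb.1).2 (hlt.trans hb.2))⟩
  exact (Finset.card_lt_card hss).ne hr.symm

/-- The backward ranks of `0, …, n - 1` determine the order in which these numbers appear. -/
theorem symm_lt_symm_iff_of_backwardRank_eq {n : ℕ} {σ τ : SInf}
    (hr : ∀ l < n, backwardRank l σ = backwardRank l τ) :
    ∀ a < n, ∀ b < n, σ.symm a < σ.symm b ↔ τ.symm a < τ.symm b := by
  induction n with
  | zero => exact fun a ha => absurd ha (Nat.not_lt_zero a)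
  | succ n ih =>
    have ho := ih fun l hl => hr l (by omega)
    have hn : ∀ a < n, (σ.symm n < σ.symm a ↔ τ.symm n < τ.symm a) := fun a ha =>
      ⟨symm_lt_symm_of_backwardRank_eq ho (hr n (by omega)) ha,
        symm_lt_symm_of_backwardRank_eq (fun a ha b hb => (ho a ha b hb).symm)
          (hr n (by omega)).symm ha⟩
    intro a ha b hb
    rcases Nat.lt_succ_iff_lt_or_eq.1 ha with ha | rfl <;>
      rcases Nat.lt_succ_iff_lt_or_eq.1 hb with hb | rfl
    · exact ho a ha b hb
    · have h1 : σ.symm a ≠ σ.symm b := fun he => ha.ne (σ.symm.injective he)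
      have h2 : τ.symm a ≠ τ.symm b := fun he => ha.ne (τ.symm.injective he)
      have := hn a ha
      omega
    · exact hn b hb
    · simp

/-- The position of `j` counts the entries before it, and a lower bound for that count is already
witnessed among finitely many values. Positions are thereby recovered from the relative orders,
hence from the ranks. -/
theorem le_symm_apply_iff {σ : SInf} {i j : ℕ} :
    i ≤ σ.symm j ↔ ∃ n, i ≤ ((Finset.range n).filter fun m => σ.symm m < σ.symm j).card := by
  constructor
  · intro h
    -- This bound exceeds each of the first `i` entries.
    refine ⟨(Finset.range i).sup (fun k => σ k + 1), ?_⟩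
    calc i = ((Finset.range i).map σ.toEmbedding).card := by simp
      _ ≤ _ := Finset.card_le_card fun m hm => by
        simp only [Finset.mem_map, Finset.mem_range, Equiv.coe_toEmbedding] at hm
        obtain ⟨k, hk, rfl⟩ := hm
        simp only [Finset.mem_filter, Finset.mem_range, Equiv.symm_apply_apply]
        have := Finset.le_sup (f := fun k => σ k + 1) (Finset.mem_range.2 hk)
        exact ⟨this, by omega⟩
  · rintro ⟨n, hn⟩
    refine hn.trans ?_
    calc _ ≤ ((Finset.range (σ.symm j)).map σ.toEmbedding).card :=
          Finset.card_le_card fun m hm => by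
            simp only [Finset.mem_filter, Finset.mem_range] at hm
            simp only [Finset.mem_map, Finset.mem_range, Equiv.coe_toEmbedding]
            exact ⟨σ.symm m, hm.2, by simp⟩
      _ = _ := by simp

/-- The σ-algebra on the permutations is generated by the backward ranks. -/
theorem sInf_measurableSpace_le_comap_backwardRank :
    (inferInstance : MeasurableSpace SInf) ≤
      MeasurableSpace.comap (fun (σ : SInf) (j : ℕ) => backwardRank j σ) inferInstance := by
  let R : SInf → ℕ → ℕ := fun σ j => backwardRank j σ
  let M : MeasurableSpace SInf := MeasurableSpace.comap R inferInstance
  have hR : @Measurable _ _ M _ R := comap_measurable R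
  have hle : ∀ i j, MeasurableSet[M] {σ : SInf | i ≤ σ.symm j} := fun i j => by
    have : {σ : SInf | i ≤ σ.symm j} = ⋃ n, {σ : SInf |
        i ≤ ((Finset.range n).filter fun m => σ.symm m < σ.symm j).card} := by
      ext σ
      rw [Set.mem_iUnion]
      exact le_symm_apply_iff
    rw [this]
    refine @MeasurableSet.iUnion _ _ M _ _ fun n => ?_
    refine @measurableSet_of_factor SInf (Fin (n + j + 1) → ℕ) M _ _
      (fun σ l => backwardRank l σ) ?_ _ fun σ τ h hσ => ?_
    · exact @measurable_pi_lambda _ _ _ M _ _ fun l =>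
        (measurable_pi_apply (l : ℕ)).comp hR
    · have ho := symm_lt_symm_iff_of_backwardRank_eq (n := n + j + 1) (σ := σ) (τ := τ)
        fun l hl => congrFun h ⟨l, hl⟩
      have : (Finset.range n).filter (fun m => τ.symm m < τ.symm j) =
          (Finset.range n).filter (fun m => σ.symm m < σ.symm j) :=
        Finset.filter_congr fun m hm => by
          rw [Finset.mem_range] at hm
          exact (ho m (by omega) j (by omega)).symm
      rw [Set.mem_ofPred_eq] at hσ ⊢
      rwa [this]
  refine iSup_le fun i => ?_
  refine (@measurable_to_countable' ℕ SInf _ _ M (fun σ : SInf => σ i) fun j => ?_).comap_le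
  have : (fun σ : SInf => σ i) ⁻¹' {j} =
      {σ : SInf | i ≤ σ.symm j} \ {σ : SInf | i + 1 ≤ σ.symm j} := by
    ext σ
    simp only [Set.mem_preimage, Set.mem_singleton_iff, Set.mem_sdiff, Set.mem_ofPred_eq]
    rw [← Equiv.eq_symm_apply]
    omega
  rw [this]
  exact @MeasurableSet.diff _ M _ _ (hle _ _) (hle _ _)

theorem measure_ext_of_map_backwardRank {P Q : Measure SInf}
    (h : P.map (fun (σ : SInf) (j : ℕ) => backwardRank j σ) =
      Q.map (fun (σ : SInf) (j : ℕ) => backwardRank j σ)) : P = Q := by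
  have hR : Measurable (fun (σ : SInf) (j : ℕ) => backwardRank j σ) :=
    measurable_pi_lambda _ measurable_backwardRank
  refine Measure.ext fun A hA => ?_
  obtain ⟨B, hB, rfl⟩ := sInf_measurableSpace_le_comap_backwardRank A hA
  rw [← Measure.map_apply hR hB, h, Measure.map_apply hR hB]

/-! ### Projections, tails and blocks of a permutation -/

theorem nth_eq_of_forall_lt {p : ℕ → Prop} {n : ℕ} (h : ∀ i < n, p i) {i : ℕ} (hi : i < n) :
    Nat.nth p i = i := by
  classical
  have hc : Nat.count p i = i := by
    rw [Nat.count_eq_card_filter_range, Finset.filter_true_of_mem, Finset.card_range]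
    exact fun j hj => h j ((Finset.mem_range.1 hj).trans hi)
  conv_lhs => rw [← hc]
  exact Nat.nth_count (h i hi)

theorem proj_apply_of_isRenewal {n : ℕ} {σ : SInf} (h : IsRenewal σ n) (i : Fin n) :
    (proj n σ i : ℕ) = σ i := by
  change σ (Nat.nth (fun k => σ k < n) i) = σ i
  rw [nth_eq_of_forall_lt (p := fun k => σ k < n) (fun j hj => (h.apply_lt_iff j).2 hj) i.isLt]

theorem backwardRank_of_proj_zero {n : ℕ} {σ : SInf} (h : proj (n + 1) σ 0 = Fin.last n) :
    backwardRank n σ = n := by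
  have h0 : σ (Nat.nth (fun k => σ k < n + 1) 0) = n := congrArg Fin.val h
  have h1 : σ.symm n = Nat.nth (fun k => σ k < n + 1) 0 := by rw [Equiv.symm_apply_eq, h0]
  refine backwardRank_eq_self_iff.2 fun i hi => lt_of_le_of_ne ?_ fun he => ?_
  · rw [h1, Nat.nth_zero]
    refine Nat.sInf_le ?_
    rw [Set.mem_ofPred_eq, Equiv.apply_symm_apply]
    omega
  · exact hi.ne' (σ.symm.injective he)

theorem tail_bijective {σ : SInf} {m : ℕ} (h : IsRenewal σ m) :
    Function.Bijective fun k => σ (m + k) - m := by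
  have hge : ∀ k, m ≤ σ (m + k) := fun k => by
    have := h.apply_lt_iff (m + k)
    omega
  constructor
  · intro i j hij
    have hi := hge i
    have hj := hge j
    simp only at hij
    have : m + i = m + j := σ.injective (by omega)
    omega
  · intro y
    have hx := h.symm_apply_lt_iff (m + y)
    refine ⟨σ.symm (m + y) - m, ?_⟩
    simp only
    rw [Nat.add_sub_cancel' (by omega), Equiv.apply_symm_apply]
    omega

open Classical in
/-- For a renewal `m` of `σ`, the permutation formed by the entries after the first `m` ones,
with `m` subtracted from the positions and from the values. -/
noncomputable def tail (σ : SInf) (m : ℕ) : SInf :=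
  if h : IsRenewal σ m then Equiv.ofBijective _ (tail_bijective h) else 1

theorem add_tail_apply {σ : SInf} {m : ℕ} (h : IsRenewal σ m) (k : ℕ) :
    m + tail σ m k = σ (m + k) := by
  have := h.apply_lt_iff (m + k)
  rw [tail, dif_pos h]
  change m + (σ (m + k) - m) = _
  omega

theorem isRenewal_tail_iff {σ : SInf} {m : ℕ} (h : IsRenewal σ m) (n : ℕ) :
    IsRenewal (tail σ m) n ↔ IsRenewal σ (m + n) := by
  rw [isRenewal_iff, isRenewal_iff]
  constructor
  · intro h' i hi
    by_cases him : i < m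
    · have := (h.apply_lt_iff i).2 him
      omega
    · obtain ⟨j, rfl⟩ := Nat.exists_eq_add_of_le (not_lt.1 him)
      have := h' j (by omega)
      rw [← add_tail_apply h]
      omega
  · intro h' i hi
    have := h' (m + i) (by omega)
    rw [← add_tail_apply h] at this
    omega

theorem backwardRank_tail_one {σ : SInf} (h : IsRenewal σ 1) (j : ℕ) :
    backwardRank j (tail σ 1) = backwardRank (j + 1) σ := by
  rw [← backwardRank_skip (v := 0) (isRenewal_one_iff.1 h) (τ := tail σ 1), skip_of_le j.zero_le]
  intro k
  rw [skip_of_le (Nat.zero_le _), add_comm k, ← add_tail_apply h, add_comm]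

instance : Countable FinPerm := by
  unfold FinPerm
  infer_instance

instance : DiscreteMeasurableSpace FinPerm := ⟨fun _ => trivial⟩

/-- The entries of a finite permutation, continued by zeros. -/
def FinPerm.val (b : FinPerm) (i : ℕ) : ℕ := if h : i < b.1 then b.2 ⟨i, h⟩ else 0

/-- Comparing entries through `val` avoids transport along an equality of sizes. -/
theorem FinPerm.ext_val {b c : FinPerm} (h1 : b.1 = c.1) (h : ∀ i < b.1, b.val i = c.val i) :
    b = c := by
  obtain ⟨m, σ⟩ := b
  obtain ⟨n, τ⟩ := c
  obtain rfl : m = n := h1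
  refine congrArg (Sigma.mk m) (Equiv.ext fun i => Fin.ext ?_)
  have := h i i.isLt
  exact ((dif_pos i.isLt).symm.trans this).trans (dif_pos i.isLt)

theorem red_val {σ : SInf} {a b : ℕ} (ha : IsRenewal σ a) (hb : IsRenewal σ b) {i : ℕ}
    (hi : i < b - a) : (red σ a b).val i = σ (a + i) - a := by
  refine (dif_pos (show i < (red σ a b).1 from hi)).trans ?_
  simp only [red, dif_pos (And.intro ha hb)]
  rfl

theorem red_congr {σ τ : SInf} {a b : ℕ} (h : ∀ i < a + b, σ i = τ i) :
    red σ a b = red τ a b := by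
  have hr : ∀ c ≤ a + b, IsRenewal σ c ↔ IsRenewal τ c := fun c hc => by
    rw [isRenewal_iff, isRenewal_iff]
    exact forall₂_congr fun i hi => by rw [h i (by omega)]
  by_cases hab : IsRenewal σ a ∧ IsRenewal σ b
  · have hab' : IsRenewal τ a ∧ IsRenewal τ b :=
      ⟨(hr a (by omega)).1 hab.1, (hr b (by omega)).1 hab.2⟩
    refine FinPerm.ext_val rfl fun i (hi : i < b - a) => ?_
    rw [red_val hab.1 hab.2 hi, red_val hab'.1 hab'.2 hi, h _ (by omega)]
  · have hab' : ¬ (IsRenewal τ a ∧ IsRenewal τ b) := fun h' =>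
      hab ⟨(hr a (by omega)).2 h'.1, (hr b (by omega)).2 h'.2⟩
    rw [red, red, dif_neg hab, dif_neg hab']

theorem red_tail {σ : SInf} {m a b : ℕ} (h : IsRenewal σ m) (ha : IsRenewal σ (m + a))
    (hb : IsRenewal σ (m + b)) : red (tail σ m) a b = red σ (m + a) (m + b) := by
  have hsz : b - a = m + b - (m + a) := by omega
  refine FinPerm.ext_val hsz fun i (hi : i < b - a) => ?_
  rw [red_val ((isRenewal_tail_iff h a).2 ha) ((isRenewal_tail_iff h b).2 hb) hi,
    red_val ha hb (by omega), add_assoc, ← add_tail_apply h]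
  omega

theorem measurable_red (a b : ℕ) : Measurable fun σ : SInf => red σ a b :=
  measurable_of_factor (R := fun (σ : SInf) (i : Fin (a + b)) => σ i)
    (measurable_pi_lambda _ fun i => measurable_sInf_apply i)
    fun _ _ h => red_congr fun i hi => congrFun h ⟨i, hi⟩

open Classical in
theorem renewalTime_count {σ : SInf} {m : ℕ} (h : IsRenewal σ m) :
    renewalTime (Nat.count (IsRenewal σ) m) σ = m := Nat.nth_count h

open Classical in
theorem renewalTime_eq_iff {σ : SInf} {k m : ℕ} (hm : m ≠ 0) :
    renewalTime k σ = m ↔ IsRenewal σ m ∧ Nat.count (IsRenewal σ) m = k := by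
  constructor
  · rintro rfl
    exact ⟨Nat.nth_mem_of_ne_zero hm, Nat.count_nth (Nat.lt_card_toFinset_of_nth_ne_zero hm)⟩
  · rintro ⟨h, rfl⟩
    exact renewalTime_count h

theorem measurable_renewalTime (k : ℕ) : Measurable (renewalTime k) := by
  classical
  -- A nonzero value is decided by finitely many entries. The value `0` may also be the default of
  -- `Nat.nth`, so it is handled as the complement.
  have hs : ∀ m, m ≠ 0 → MeasurableSet {σ : SInf | renewalTime k σ = m} := fun m hm => by
    refine measurableSet_of_factor (R := fun (σ : SInf) (i : Fin (m + 1)) => σ i)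
      (measurable_pi_lambda _ fun i => measurable_sInf_apply i) fun σ τ h hσ => ?_
    have hr : ∀ c ≤ m, IsRenewal σ c ↔ IsRenewal τ c := fun c hc => by
      rw [isRenewal_iff, isRenewal_iff]
      exact forall₂_congr fun i hi => by rw [show σ i = τ i from congrFun h ⟨i, by omega⟩]
    rw [Set.mem_ofPred_eq, renewalTime_eq_iff hm] at hσ ⊢
    refine ⟨(hr m le_rfl).1 hσ.1, ?_⟩
    rw [← hσ.2, Nat.count_eq_card_filter_range, Nat.count_eq_card_filter_range]
    congr 1
    exact Finset.filter_congr fun i hi => (hr i (Finset.mem_range.1 hi).le).symm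
  refine measurable_to_countable' fun m => ?_
  rcases m with _ | m
  · have : renewalTime k ⁻¹' {0} = (⋃ m, {σ : SInf | renewalTime k σ = m + 1})ᶜ := by
      ext σ
      simp only [Set.mem_preimage, Set.mem_singleton_iff, Set.mem_compl_iff, Set.mem_iUnion,
        Set.mem_ofPred_eq, not_exists]
      exact ⟨fun h m => by omega, fun h => by
        by_contra h0
        obtain ⟨m, hm⟩ := Nat.exists_eq_succ_of_ne_zero h0
        exact h m hm⟩
    rw [this]
    exact (MeasurableSet.iUnion fun m => hs (m + 1) m.succ_ne_zero).compl
  · exact hs (m + 1) m.succ_ne_zero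

theorem measurable_block (k : ℕ) : Measurable (block k) := by
  intro B _
  have : block k ⁻¹' B = ⋃ a, ⋃ b, renewalTime k ⁻¹' {a} ∩ (renewalTime (k + 1) ⁻¹' {b} ∩
      (fun σ : SInf => red σ a b) ⁻¹' B) := by
    ext σ
    simp [block]
  rw [this]
  exact MeasurableSet.iUnion fun a => MeasurableSet.iUnion fun b =>
    (measurable_renewalTime k (measurableSet_singleton a)).inter
      ((measurable_renewalTime (k + 1) (measurableSet_singleton b)).inter
        (measurable_red a b MeasurableSet.of_discrete))

section InfinitelyManyRenewals

variable {σ τ : SInf}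

theorem isRenewal_renewalTime (h : {m : ℕ | IsRenewal σ m}.Infinite) (k : ℕ) :
    IsRenewal σ (renewalTime k σ) := Nat.nth_mem_of_infinite h k

theorem renewalTime_lt_succ (h : {m : ℕ | IsRenewal σ m}.Infinite) (k : ℕ) :
    renewalTime k σ < renewalTime (k + 1) σ := Nat.nth_strictMono h k.lt_succ_self

theorem renewalTime_zero (σ : SInf) : renewalTime 0 σ = 0 :=
  Nat.nth_zero_of_zero (isRenewal_zero σ)

theorem block_zero_eq_iff (h : {m : ℕ | IsRenewal σ m}.Infinite) {b : FinPerm} :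
    block 0 σ = b ↔ 0 < b.1 ∧ IsRenewal σ b.1 ∧ (∀ l, 0 < l → l < b.1 → ¬ IsRenewal σ l) ∧
      ∀ i < b.1, σ i = b.val i := by
  classical
  constructor
  · rintro rfl
    have h1 : (block 0 σ).1 = renewalTime 1 σ := by
      change renewalTime 1 σ - renewalTime 0 σ = _
      rw [renewalTime_zero, Nat.sub_zero]
    have h2 : block 0 σ = red σ 0 (renewalTime 1 σ) := by
      rw [block, renewalTime_zero]
    have h3 := renewalTime_lt_succ h 0
    rw [renewalTime_zero] at h3
    rw [h1]
    refine ⟨h3, isRenewal_renewalTime h 1, fun l hl hlt hr => ?_, fun i hi => ?_⟩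
    · have := Nat.le_nth_of_lt_nth_succ (p := IsRenewal σ) (k := 0) hlt hr
      change l ≤ renewalTime 0 σ at this
      rw [renewalTime_zero] at this
      omega
    · rw [h2, red_val (isRenewal_zero σ) (isRenewal_renewalTime h 1) (by simpa using hi)]
      simp
  · rintro ⟨h0, hr, hl, hv⟩
    have hc : Nat.count (IsRenewal σ) b.1 = 1 := by
      rw [Nat.count_eq_card_filter_range, Finset.card_eq_one]
      refine ⟨0, ?_⟩
      ext l
      simp only [Finset.mem_filter, Finset.mem_range, Finset.mem_singleton]
      constructor
      · rintro ⟨h1, h2⟩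
        by_contra h3
        exact hl l (Nat.pos_of_ne_zero h3) h1 h2
      · rintro rfl
        exact ⟨h0, isRenewal_zero σ⟩
    have h1 : renewalTime 1 σ = b.1 := (renewalTime_eq_iff h0.ne').2 ⟨hr, hc⟩
    rw [block, renewalTime_zero, h1]
    refine FinPerm.ext_val (Nat.sub_zero _) fun i (hi : i < b.1 - 0) => ?_
    rw [red_val (isRenewal_zero σ) hr hi, zero_add, Nat.sub_zero]
    exact hv i hi

theorem infinite_isRenewal_tail_iff {m : ℕ} (hm : IsRenewal σ m) :
    {n : ℕ | IsRenewal (tail σ m) n}.Infinite ↔ {n : ℕ | IsRenewal σ n}.Infinite := by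
  rw [Set.infinite_iff_exists_gt, Set.infinite_iff_exists_gt]
  constructor
  · intro h a
    obtain ⟨n, hn, han⟩ := h a
    exact ⟨m + n, (isRenewal_tail_iff hm n).1 hn, by omega⟩
  · intro h a
    obtain ⟨n, hn, han⟩ := h (m + a)
    refine ⟨n - m, (isRenewal_tail_iff hm _).2 ?_, by omega⟩
    rw [Nat.add_sub_cancel' (by omega)]
    exact hn

/-- Below the first positive renewal there is only the renewal `0`; from there on, the renewals are
those of the tail, translated. Counting both ranges gives the index. -/
theorem renewalTime_tail (h : {m : ℕ | IsRenewal σ m}.Infinite) (k : ℕ) :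
    renewalTime 1 σ + renewalTime k (tail σ (renewalTime 1 σ)) = renewalTime (k + 1) σ := by
  classical
  have hm := isRenewal_renewalTime h 1
  set m := renewalTime 1 σ with hmdef
  have ht := (infinite_isRenewal_tail_iff hm).2 h
  have hr := isRenewal_renewalTime ht k
  rw [isRenewal_tail_iff hm] at hr
  have hc := renewalTime_count hr
  rw [Nat.count_add] at hc
  have h1 : Nat.count (IsRenewal σ) m = 1 := Nat.count_nth_of_infinite h 1
  have h2 : Nat.count (fun j => IsRenewal σ (m + j)) (renewalTime k (tail σ m)) = k := by
    have : (fun j => IsRenewal σ (m + j)) = IsRenewal (tail σ m) := by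
      ext j
      exact (isRenewal_tail_iff hm j).symm
    simp_rw [this]
    exact Nat.count_nth_of_infinite ht k
  rw [h1, h2, add_comm 1 k] at hc
  exact hc.symm

theorem block_tail (h : {m : ℕ | IsRenewal σ m}.Infinite) (k : ℕ) :
    block k (tail σ (renewalTime 1 σ)) = block (k + 1) σ := by
  have hm := isRenewal_renewalTime h 1
  rw [block, red_tail hm, renewalTime_tail h, renewalTime_tail h, block]
  · rw [renewalTime_tail h]
    exact isRenewal_renewalTime h _
  · rw [renewalTime_tail h]
    exact isRenewal_renewalTime h _

/-- The first `n` blocks determine the permutation up to the `n`-th renewal. -/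
theorem eq_of_block_eq (hσ : {m : ℕ | IsRenewal σ m}.Infinite)
    (hτ : {m : ℕ | IsRenewal τ m}.Infinite) {n : ℕ} (h : ∀ k < n, block k σ = block k τ) :
    renewalTime n σ = renewalTime n τ ∧ ∀ i < renewalTime n σ, σ i = τ i := by
  induction n with
  | zero => simp [renewalTime_zero]
  | succ n ih =>
    obtain ⟨h1, h2⟩ := ih fun k hk => h k (by omega)
    have hb := h n (by omega)
    have hs : renewalTime (n + 1) σ - renewalTime n σ = renewalTime (n + 1) τ - renewalTime n τ :=
      congrArg Sigma.fst hb
    have h3 := renewalTime_lt_succ hσ n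
    have h4 := renewalTime_lt_succ hτ n
    refine ⟨by omega, fun i hi => ?_⟩
    by_cases hin : i < renewalTime n σ
    · exact h2 i hin
    · obtain ⟨j, rfl⟩ := Nat.exists_eq_add_of_le (not_lt.1 hin)
      have hv := congrArg (fun b => FinPerm.val b j) hb
      simp only [block] at hv
      rw [red_val (isRenewal_renewalTime hσ _) (isRenewal_renewalTime hσ _) (by omega),
        red_val (isRenewal_renewalTime hτ _) (isRenewal_renewalTime hτ _) (by omega)] at hv
      have h5 := (isRenewal_renewalTime hσ n).apply_lt_iff (renewalTime n σ + j)
      have h6 := (isRenewal_renewalTime hτ n).apply_lt_iff (renewalTime n τ + j)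
      rw [← h1] at hv h6
      omega

theorem le_renewalTime (h : {m : ℕ | IsRenewal σ m}.Infinite) (k : ℕ) : k ≤ renewalTime k σ :=
  (Nat.nth_strictMono h).le_apply

/-- Blocks are nonempty, so the first `j + 1` of them contain all numbers up to `j` together with
their positions. -/
theorem backwardRank_eq_of_block_eq (hσ : {m : ℕ | IsRenewal σ m}.Infinite)
    (hτ : {m : ℕ | IsRenewal τ m}.Infinite) {j : ℕ} (h : ∀ k < j + 1, block k σ = block k τ) :
    backwardRank j σ = backwardRank j τ := by
  obtain ⟨-, h2⟩ := eq_of_block_eq hσ hτ h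
  have hj := le_renewalTime hσ (j + 1)
  have hs : ∀ i ≤ j, σ.symm i = τ.symm i := fun i hi => by
    rw [Equiv.eq_symm_apply, ← h2, Equiv.apply_symm_apply]
    rw [(isRenewal_renewalTime hσ (j + 1)).symm_apply_lt_iff]
    omega
  unfold backwardRank
  congr 1
  refine Finset.filter_congr fun i hi => ?_
  rw [hs j le_rfl, hs i (Finset.mem_range.1 hi).le]

end InfinitelyManyRenewals

theorem shiftedPerm_shift {s : ℕ → ℕ} (hs : Function.Bijective (shiftedSeq s)) {m : ℕ}
    (hm : SeqRenewal s m) :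
    Function.Bijective (shiftedSeq (shift m s)) ∧
      shiftedPerm (shift m s) = tail (shiftedPerm s) m := by
  have hr := (isRenewal_shiftedPerm_iff hs m).2 hm
  have he : ∀ k, shiftedSeq (shift m s) k = tail (shiftedPerm s) m k := fun k => by
    have := add_tail_apply hr k
    rw [shiftedPerm_apply hs, hm.shiftedSeq_add] at this
    omega
  have hb : Function.Bijective (shiftedSeq (shift m s)) := by
    rw [show shiftedSeq (shift m s) = tail (shiftedPerm s) m from funext he]
    exact (tail _ _).bijective
  exact ⟨hb, Equiv.ext fun k => by rw [shiftedPerm_apply hb, he]⟩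

/-! ### Tail sums, infinite products and the renewal equation -/

theorem lintegral_natCast_eq_tsum {Ω : Type*} [MeasurableSpace Ω] (P : Measure Ω) {f : Ω → ℕ}
    (hf : Measurable f) : ∫⁻ ω, (f ω : ENNReal) ∂P = ∑' n, P {ω | n < f ω} := by
  have hm : ∀ n, MeasurableSet {ω | n < f ω} := fun n => hf (measurableSet_Ioi (a := n))
  have h : ∀ ω, (f ω : ENNReal) = ∑' n, {ω | n < f ω}.indicator 1 ω := fun ω => by
    rw [tsum_eq_sum (s := Finset.range (f ω))]
    · rw [Finset.sum_congr rfl fun n hn => Set.indicator_of_mem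
        (show ω ∈ {ω | n < f ω} from Finset.mem_range.1 hn) 1]
      simp
    · exact fun n hn => Set.indicator_of_notMem
        (fun h : n < f ω => hn (Finset.mem_range.2 h)) 1
  simp_rw [h]
  rw [lintegral_tsum fun n => (measurable_one.indicator (hm n)).aemeasurable]
  simp_rw [lintegral_indicator_one (hm _)]

section ProductsAndSums

variable {F t : ℕ → ENNReal}

theorem le_one_of_add_eq_one (h : ∀ i, F i + t i = 1) (i : ℕ) : F i ≤ 1 := (h i) ▸ le_self_add

theorem antitone_prod_of_add_eq_one (h : ∀ i, F i + t i = 1) :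
    Antitone fun n => ∏ i ∈ Finset.range n, F i :=
  antitone_nat_of_succ_le fun n => by
    rw [Finset.prod_range_succ]
    exact mul_le_of_le_one_right' (le_one_of_add_eq_one h n)

/-- A lower bound for the products then bounds the partial sums of `t`. The induction uses F(1 + A +
t) ≤ (F + t)(1 + A) = 1 + A. -/
theorem prod_mul_one_add_sum_le (h : ∀ i, F i + t i = 1) (n : ℕ) :
    (∏ i ∈ Finset.range n, F i) * (1 + ∑ i ∈ Finset.range n, t i) ≤ 1 := by
  induction n with
  | zero => simp
  | succ n ih =>
    refine le_trans ?_ ih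
    rw [Finset.prod_range_succ, Finset.sum_range_succ, mul_assoc]
    gcongr
    set A := ∑ i ∈ Finset.range n, t i
    calc F n * (1 + (A + t n)) = F n * (1 + A) + F n * t n := by ring
      _ ≤ F n * (1 + A) + t n * (1 + A) := by
          rw [mul_comm (F n) (t n)]
          gcongr
          exact (le_one_of_add_eq_one h n).trans le_self_add
      _ = 1 + A := by rw [← add_mul, h, one_mul]

/-- Each further factor lowers the product by `t` times its current value, which is at most the
value at `M`. Once the sum of `t` beyond `M` is at most 1/2, half of the product at `M` survives. -/
theorem prod_le_prod_add (h : ∀ i, F i + t i = 1) (M n : ℕ) :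
    ∏ i ∈ Finset.range M, F i ≤ ∏ i ∈ Finset.range (n + M), F i +
      (∏ i ∈ Finset.range M, F i) * ∑ i ∈ Finset.range n, t (i + M) := by
  induction n with
  | zero => simp
  | succ n ih =>
    refine ih.trans ?_
    rw [Finset.sum_range_succ, mul_add, add_comm (_ * _) (_ * _), ← add_assoc]
    gcongr
    rw [show n + 1 + M = n + M + 1 by omega, Finset.prod_range_succ]
    calc ∏ i ∈ Finset.range (n + M), F i
        = (∏ i ∈ Finset.range (n + M), F i) * F (n + M) +
            (∏ i ∈ Finset.range (n + M), F i) * t (n + M) := by rw [← mul_add, h, mul_one]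
      _ ≤ _ := by
          gcongr ?_ + ?_ * _
          · exact le_rfl
          · exact antitone_prod_of_add_eq_one h (by omega)

theorem half_le_of_le_add {a b c : ENNReal} (hc : c ≠ ⊤) (h : c ≤ a + b) (hb : b ≤ c / 2) :
    c / 2 ≤ a := by
  have h2 : c / 2 + c / 2 ≤ a + c / 2 := by
    rw [ENNReal.add_halves]
    exact h.trans (by gcongr)
  exact (ENNReal.add_le_add_iff_right (ENNReal.div_ne_top hc two_ne_zero)).1 h2

theorem exists_tsum_add_le {f : ℕ → ENNReal} (hf : ∑' i, f i ≠ ⊤) {c : ENNReal} (hc : 0 < c) :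
    ∃ M, ∑' k, f (k + M) ≤ c :=
  ((ENNReal.tendsto_sum_nat_add f hf).eventually (ge_mem_nhds hc)).exists

/-- An infinite product of numbers in `(0, 1]` is positive if and only if the sum of the
complements is finite. -/
theorem exists_le_prod_iff_tsum_lt_top (h : ∀ i, F i + t i = 1) (hF : ∀ i, F i ≠ 0) :
    (∃ c, 0 < c ∧ ∀ n, c ≤ ∏ i ∈ Finset.range n, F i) ↔ ∑' i, t i < ⊤ := by
  constructor
  · rintro ⟨c, hc, hn⟩
    refine lt_of_le_of_lt (ENNReal.tsum_le_of_sum_range_le (c := c⁻¹) fun n => ?_)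
      (ENNReal.inv_lt_top.2 hc)
    rw [ENNReal.le_inv_iff_mul_le, mul_comm]
    refine le_trans ?_ (prod_mul_one_add_sum_le h n)
    exact mul_le_mul' (hn n) le_add_self
  · intro hs
    obtain ⟨M, hM⟩ := exists_tsum_add_le hs.ne (show (0 : ENNReal) < 1 / 2 by simp)
    set c := ∏ i ∈ Finset.range M, F i with hcdef
    have hc0 : c ≠ 0 := Finset.prod_ne_zero_iff.2 fun i _ => hF i
    have hct : c ≠ ⊤ := ENNReal.prod_ne_top fun i _ =>
      ne_top_of_le_ne_top ENNReal.one_ne_top (le_one_of_add_eq_one h i)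
    refine ⟨c / 2, ENNReal.half_pos hc0, fun n => ?_⟩
    refine le_trans ?_ (antitone_prod_of_add_eq_one h (show n ≤ n + M by omega))
    refine half_le_of_le_add hct (prod_le_prod_add h M n) ?_
    rw [← hcdef, ENNReal.div_eq_inv_mul, mul_comm _ c]
    gcongr
    rw [← one_div]
    exact (ENNReal.sum_le_tsum _).trans hM

/-- For `u` nonincreasing, the renewal equation shows that `u` is bounded away from zero if and only
if the mean of the renewal gaps is finite. -/
theorem exists_le_iff_tsum_lt_top_of_renewal {u v : ℕ → ENNReal} (hu : Antitone u)
    (hu1 : ∀ n, u n ≤ 1) (hv : ∀ n, v n ≤ 1)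
    (h : ∀ n, ∑ k ∈ Finset.range (n + 1), u (n - k) * v k = 1) :
    (∃ c, 0 < c ∧ ∀ n, c ≤ u n) ↔ ∑' n, v n < ⊤ := by
  constructor
  · rintro ⟨c, hc, hn⟩
    refine lt_of_le_of_lt (ENNReal.tsum_le_of_sum_range_le (c := c⁻¹) fun n => ?_)
      (ENNReal.inv_lt_top.2 hc)
    rw [ENNReal.le_inv_iff_mul_le, mul_comm, ← h n, Finset.mul_sum]
    refine (Finset.sum_le_sum fun k _ => mul_le_mul' (hn (n - k)) le_rfl).trans ?_
    exact Finset.sum_le_sum_of_subset (Finset.range_mono n.le_succ)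
  · intro hs
    obtain ⟨M, hM⟩ := exists_tsum_add_le hs.ne (show (0 : ENNReal) < 1 / 2 by simp)
    -- In the renewal equation at time `n + M`, the terms with `k ≥ M` contribute at most 1/2, and
    -- the first `M` terms at most `M * u n` by monotonicity. The denominator `M + 1` also covers `M
    -- = 0`.
    refine ⟨1 / 2 / (M + 1 : ℕ), ENNReal.div_pos (by simp) (ENNReal.natCast_ne_top _),
      fun n => ?_⟩
    rw [ENNReal.div_le_iff (by simp) (ENNReal.natCast_ne_top _)]
    refine half_le_of_le_add ENNReal.one_ne_top ?_ hM
    rw [← h (n + M), show n + M + 1 = M + (n + 1) by omega, Finset.sum_range_add]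
    gcongr
    · calc ∑ k ∈ Finset.range M, u (n + M - k) * v k ≤ ∑ k ∈ Finset.range M, u n * 1 :=
            Finset.sum_le_sum fun k hk =>
              mul_le_mul' (hu (by have := Finset.mem_range.1 hk; omega)) (hv k)
        _ = u n * M := by simp [mul_comm]
        _ ≤ u n * (M + 1 : ℕ) := by gcongr; omega
    · refine le_trans (Finset.sum_le_sum fun k _ => ?_) (ENNReal.sum_le_tsum (Finset.range (n + 1)))
      rw [add_comm M k]
      exact mul_le_of_le_one_left' (hu1 _)

end ProductsAndSums

/-! ### Renewal probabilities under independent sampling -/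

/-- The law of a sequence of independent samples from `p`. -/
noncomputable def sampleLaw (p : PMF ℕ) : Measure (ℕ → ℕ) :=
  Measure.infinitePi fun _ : ℕ => p.toMeasure

instance (p : PMF ℕ) : IsProbabilityMeasure (sampleLaw p) := by
  unfold sampleLaw
  infer_instance

instance (p : PMF ℕ) : IsProbabilityMeasure (pShifted p) :=
  Measure.isProbabilityMeasure_map measurable_shiftedPerm.aemeasurable

theorem pShifted_apply (p : PMF ℕ) {A : Set SInf} (hA : MeasurableSet A) :
    pShifted p A = sampleLaw p (shiftedPerm ⁻¹' A) :=
  Measure.map_apply measurable_shiftedPerm hA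

theorem ae_pShifted_iff (p : PMF ℕ) {A : SInf → Prop} (hA : MeasurableSet {σ | A σ}) :
    (∀ᵐ σ ∂pShifted p, A σ) ↔ ∀ᵐ s ∂sampleLaw p, A (shiftedPerm s) :=
  ae_map_iff measurable_shiftedPerm.aemeasurable hA

variable {p : PMF ℕ}

/-- The probability of no zero among `n` samples is the `n`-th power of a number below one, hence
tends to zero; finitely many zeros would leave some shift without any. -/
theorem ae_infinite_eq_zero (hp : 0 < p 0) : ∀ᵐ s ∂sampleLaw p, {k | s k = 0}.Infinite := by
  have hnull : sampleLaw p {s | ∀ k, s k ≠ 0} = 0 := by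
    have hq : p.toMeasure {0}ᶜ < 1 := by
      rw [prob_compl_eq_one_sub (measurableSet_singleton 0),
        PMF.toMeasure_apply_singleton _ _ (measurableSet_singleton 0)]
      exact ENNReal.sub_lt_self ENNReal.one_ne_top one_ne_zero hp.ne'
    refine le_antisymm (ge_of_tendsto' (ENNReal.tendsto_pow_atTop_nhds_zero_of_lt_one hq)
      fun n => ?_) zero_le
    have := Measure.infinitePi_pi (fun _ : ℕ => p.toMeasure) (s := Finset.range n)
      (t := fun _ => {0}ᶜ) fun _ _ => MeasurableSet.of_discrete
    rw [Finset.prod_const, Finset.card_range] at this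
    rw [← this]
    exact measure_mono fun s hs k _ => hs k
  have hN : ∀ N, sampleLaw p (shift N ⁻¹' {s | ∀ k, s k ≠ 0}) = 0 := fun N => by
    have hm : MeasurableSet {s : ℕ → ℕ | ∀ k, s k ≠ 0} := by
      have : {s : ℕ → ℕ | ∀ k, s k ≠ 0} = ⋂ k, (fun s : ℕ → ℕ => s k) ⁻¹' {0}ᶜ := by
        ext s
        simp
      rw [this]
      exact MeasurableSet.iInter fun k => measurable_pi_apply k MeasurableSet.of_discrete
    rw [← Measure.map_apply (measurable_shift N) hm, sampleLaw, map_shift_infinitePi]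
    exact hnull
  refine measure_mono_null ?_ (measure_iUnion_null hN)
  intro s hs
  rw [Set.mem_compl_iff, Set.mem_ofPred_eq, Set.not_infinite] at hs
  obtain ⟨N, hN⟩ := hs.bddAbove
  refine Set.mem_iUnion.2 ⟨N + 1, fun k hk => ?_⟩
  have := hN hk
  omega

theorem ae_bijective_shiftedSeq (hp : 0 < p 0) :
    ∀ᵐ s ∂sampleLaw p, Function.Bijective (shiftedSeq s) :=
  (ae_infinite_eq_zero hp).mono fun s hs => ⟨shiftedSeq_injective s, shiftedSeq_surjective hs⟩

theorem sampleLaw_inter_shift (p : PMF ℕ) (m : ℕ) {A B : Set (ℕ → ℕ)}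
    (hA : ∀ s t : ℕ → ℕ, (∀ i < m, s i = t i) → s ∈ A → t ∈ A) (hB : MeasurableSet B) :
    sampleLaw p (A ∩ shift m ⁻¹' B) = sampleLaw p A * sampleLaw p B :=
  infinitePi_inter_shift _ m hA hB

theorem sampleLaw_first_mem (p : PMF ℕ) (A : Set ℕ) :
    sampleLaw p {s | s 0 ∈ A} = p.toMeasure A := by
  have := Measure.infinitePi_map_eval (fun _ : ℕ => p.toMeasure) 0
  rw [← this, Measure.map_apply (measurable_pi_apply 0) MeasurableSet.of_discrete]
  rfl

/-- The distribution function `p_1 + ⋯ + p_{n+1}`. -/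
noncomputable def cdfSum (p : PMF ℕ) (n : ℕ) : ENNReal := ∑ k ∈ Finset.range (n + 1), p k

theorem cdfSum_eq (p : PMF ℕ) (n : ℕ) : cdfSum p n = p.toMeasure {k | k < n + 1} := by
  rw [cdfSum, ← PMF.toMeasure_apply_finset]
  congr 1
  ext k
  simp

theorem cdfSum_add (p : PMF ℕ) (n : ℕ) : cdfSum p n + p.toMeasure {k | n < k} = 1 := by
  rw [cdfSum_eq, ← measure_univ (μ := p.toMeasure),
    ← measure_add_measure_compl (s := {k : ℕ | k < n + 1}) MeasurableSet.of_discrete]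
  congr 2
  ext k
  simp only [Set.mem_ofPred_eq, Set.mem_compl_iff]
  omega

theorem cdfSum_ne_zero (hp : ∀ k, 0 < p k) (n : ℕ) : cdfSum p n ≠ 0 :=
  ((hp 0).trans_le (Finset.single_le_sum (f := fun k => p k) (fun _ _ => zero_le)
    (Finset.mem_range.2 n.succ_pos))).ne'

theorem cdfSum_ne_top (p : PMF ℕ) (n : ℕ) : cdfSum p n ≠ ⊤ :=
  ne_top_of_le_ne_top ENNReal.one_ne_top (le_one_of_add_eq_one (cdfSum_add p) n)

theorem sampleLaw_seqRenewal (p : PMF ℕ) (n : ℕ) :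
    sampleLaw p {s | SeqRenewal s n} = ∏ i ∈ Finset.range n, cdfSum p i := by
  induction n with
  | zero =>
    rw [Finset.prod_range_zero, ← measure_univ (μ := sampleLaw p)]
    congr 1
    ext s
    simp [seqRenewal_zero]
  | succ n ih =>
    have : {s | SeqRenewal s (n + 1)} =
        {s | s 0 ∈ {k | k < n + 1}} ∩ shift 1 ⁻¹' {s | SeqRenewal s n} := by
      ext s
      exact seqRenewal_succ_iff s n
    rw [this, sampleLaw_inter_shift p 1 (fun s t hst hs => ?_) (measurableSet_seqRenewal n),
      sampleLaw_first_mem, ih, ← cdfSum_eq, mul_comm, Finset.prod_range_succ]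
    have h0 := hst 0 one_pos
    simp only [Set.mem_ofPred_eq] at hs ⊢
    omega

/-- There is no renewal at any of the numbers `1, …, n`. -/
def NoRenewal (n : ℕ) : Set (ℕ → ℕ) := {s | ∀ l, 0 < l → l ≤ n → ¬ SeqRenewal s l}

theorem noRenewal_initial (n : ℕ) {s t : ℕ → ℕ} (hst : ∀ i < n, s i = t i)
    (hs : s ∈ NoRenewal n) : t ∈ NoRenewal n := fun l h0 hl h =>
  hs l h0 hl (h.congr fun i hi => (hst i (by omega)).symm)

theorem measurableSet_noRenewal (n : ℕ) : MeasurableSet (NoRenewal n) :=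
  measurableSet_of_initial n fun _ _ => noRenewal_initial n

/-- The renewal equation, by the last renewal at a number not exceeding `n`. -/
theorem sum_sampleLaw_seqRenewal_mul (p : PMF ℕ) (n : ℕ) :
    ∑ k ∈ Finset.range (n + 1),
      sampleLaw p {s | SeqRenewal s (n - k)} * sampleLaw p (NoRenewal k) = 1 := by
  classical
  have hmeas : ∀ k, MeasurableSet ({s | SeqRenewal s (n - k)} ∩ shift (n - k) ⁻¹' NoRenewal k) :=
    fun k => (measurableSet_seqRenewal _).inter (measurable_shift _ (measurableSet_noRenewal k))
  have h : ∀ k, sampleLaw p {s | SeqRenewal s (n - k)} * sampleLaw p (NoRenewal k) =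
      sampleLaw p ({s | SeqRenewal s (n - k)} ∩ shift (n - k) ⁻¹' NoRenewal k) := fun k =>
    (sampleLaw_inter_shift p (n - k) (fun _ _ hst hs => SeqRenewal.congr hst hs)
      (measurableSet_noRenewal k)).symm
  simp_rw [h]
  rw [← measure_biUnion_finset _ fun k _ => hmeas k, ← measure_univ (μ := sampleLaw p)]
  · congr 1
    refine Set.eq_univ_of_forall fun s => ?_
    -- The last renewal at or before `n` selects the event with `k = n - m`.
    set m := Nat.findGreatest (SeqRenewal s) n with hm
    have hmn : m ≤ n := Nat.findGreatest_le n
    have hr : SeqRenewal s m := Nat.findGreatest_spec (P := SeqRenewal s) n.zero_le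
      (seqRenewal_zero s)
    refine Set.mem_biUnion (x := n - m) (by simp) ⟨?_, ?_⟩
    · rw [Set.mem_ofPred_eq, Nat.sub_sub_self hmn]
      exact hr
    · rw [Set.mem_preimage, Nat.sub_sub_self hmn]
      intro l h0 hl hrl
      rw [← hr.add_iff] at hrl
      exact Nat.findGreatest_is_greatest (P := SeqRenewal s) (n := n) (k := m + l) (by omega)
        (by omega) hrl
  · have key : ∀ j ≤ n, ∀ k < j, ∀ s : ℕ → ℕ, SeqRenewal s (n - k) → SeqRenewal s (n - j) →
        shift (n - j) s ∉ NoRenewal j := fun j hj k hk s h1 h2 h3 => by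
      refine h3 (j - k) (by omega) (by omega) ((h2.add_iff _).1 ?_)
      rwa [show n - j + (j - k) = n - k by omega]
    intro j hj k hk hjk
    simp only [Finset.coe_range, Set.mem_Iio] at hj hk
    refine Set.disjoint_left.2 fun s hs1 hs2 => ?_
    rcases lt_or_gt_of_ne hjk with hlt | hlt
    · exact key k (by omega) j hlt s hs1.1 hs2.1 hs2.2
    · exact key j (by omega) k hlt s hs2.1 hs1.1 hs1.2

/-- The tail-sum formula; the weight is `k + 1` because `k` stands for the number `k + 1`, and the
extra `1` is the total mass. -/
theorem tsum_add_one_mul_eq (p : PMF ℕ) :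
    ∑' k : ℕ, ((k : ENNReal) + 1) * p k = ∑' n : ℕ, p.toMeasure {k | n < k} + 1 := by
  have h := lintegral_natCast_eq_tsum p.toMeasure (f := fun k => k) measurable_id
  rw [lintegral_countable'] at h
  rw [← h]
  conv_rhs => rw [← p.tsum_coe, ← ENNReal.tsum_add]
  refine tsum_congr fun k => ?_
  rw [PMF.toMeasure_apply_singleton _ _ (measurableSet_singleton k), add_mul, one_mul]

/-- The mean of `p` is finite if and only if that of the first renewal time is. -/
theorem tsum_add_one_mul_lt_top_iff (hp : ∀ k, 0 < p k) :
    ∑' k : ℕ, ((k : ENNReal) + 1) * p k < ⊤ ↔ ∑' n, sampleLaw p (NoRenewal n) < ⊤ := by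
  -- Both sides are equivalent to a positive lower bound for the products of `cdfSum p`, which are
  -- the renewal probabilities.
  rw [tsum_add_one_mul_eq, ENNReal.add_lt_top, and_iff_left ENNReal.one_lt_top,
    ← exists_le_prod_iff_tsum_lt_top (cdfSum_add p) (cdfSum_ne_zero hp)]
  refine exists_le_iff_tsum_lt_top_of_renewal (antitone_prod_of_add_eq_one (cdfSum_add p))
    (fun n => ?_) (fun n => prob_le_one) fun n => ?_
  · rw [← sampleLaw_seqRenewal]
    exact prob_le_one
  · simp_rw [← sampleLaw_seqRenewal]
    exact sum_sampleLaw_seqRenewal_mul p n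

/-- Summability makes the absence of every renewal a null event. With finitely many renewals, the
samples after the last one would have none. -/
theorem ae_infinite_seqRenewal (h : ∑' n, sampleLaw p (NoRenewal n) < ⊤) :
    ∀ᵐ s ∂sampleLaw p, {m | SeqRenewal s m}.Infinite := by
  have h0 : sampleLaw p (⋂ n, NoRenewal n) = 0 :=
    le_antisymm (ge_of_tendsto' (ENNReal.tendsto_atTop_zero_of_tsum_ne_top h.ne) fun n =>
      measure_mono (Set.iInter_subset _ n)) zero_le
  have hN : ∀ m, sampleLaw p (shift m ⁻¹' ⋂ n, NoRenewal n) = 0 := fun m => by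
    rw [← Measure.map_apply (measurable_shift m)
      (MeasurableSet.iInter measurableSet_noRenewal), sampleLaw, map_shift_infinitePi]
    exact h0
  refine measure_mono_null ?_ (measure_iUnion_null hN)
  intro s hs
  rw [Set.mem_compl_iff, Set.mem_ofPred_eq, Set.not_infinite] at hs
  have hmem := Set.Nonempty.csSup_mem ⟨0, seqRenewal_zero s⟩ hs
  refine Set.mem_iUnion.2 ⟨sSup {m | SeqRenewal s m}, Set.mem_iInter.2 fun n l hl _ hr => ?_⟩
  have hr' : SeqRenewal s (sSup {m | SeqRenewal s m} + l) := (SeqRenewal.add_iff hmem l).2 hr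
  have := le_csSup hs.bddAbove hr'
  omega

theorem lt_renewalTime_one_iff {σ : SInf} (h : {m : ℕ | IsRenewal σ m}.Infinite) (n : ℕ) :
    n < renewalTime 1 σ ↔ ∀ l, 0 < l → l ≤ n → ¬ IsRenewal σ l := by
  constructor
  · intro hn l h0 hl hr
    have := Nat.le_nth_of_lt_nth_succ (p := IsRenewal σ) (k := 0) (hl.trans_lt hn) hr
    change l ≤ renewalTime 0 σ at this
    rw [renewalTime_zero] at this
    omega
  · intro hn
    by_contra hlt
    refine hn _ ?_ (not_lt.1 hlt) (isRenewal_renewalTime h 1)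
    have : renewalTime 0 σ < renewalTime 1 σ := renewalTime_lt_succ h 0
    omega

/-- Infinitely many renewals exclude the default value of `renewalTime 1`, so its tail events are
the absence of renewals up to `n`. -/
theorem lintegral_renewalTime_one (hp : 0 < p 0)
    (h : ∀ᵐ σ ∂pShifted p, {m : ℕ | IsRenewal σ m}.Infinite) :
    ∫⁻ σ, (renewalTime 1 σ : ENNReal) ∂pShifted p = ∑' n, sampleLaw p (NoRenewal n) := by
  rw [lintegral_natCast_eq_tsum _ (measurable_renewalTime 1)]
  refine tsum_congr fun n => ?_
  have hm : MeasurableSet {σ : SInf | ∀ l, 0 < l → l ≤ n → ¬ IsRenewal σ l} := by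
    have : {σ : SInf | ∀ l, 0 < l → l ≤ n → ¬ IsRenewal σ l} =
        ⋂ l, ⋂ (_ : 0 < l), ⋂ (_ : l ≤ n), {σ : SInf | IsRenewal σ l}ᶜ := by
      ext σ
      simp
    rw [this]
    exact MeasurableSet.iInter fun l => MeasurableSet.iInter fun _ => MeasurableSet.iInter fun _ =>
      (measurableSet_isRenewal l).compl
  have h1 : pShifted p {σ | n < renewalTime 1 σ} =
      pShifted p {σ : SInf | ∀ l, 0 < l → l ≤ n → ¬ IsRenewal σ l} :=
    measure_congr (h.mono fun σ hσ => propext (lt_renewalTime_one_iff hσ n))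
  rw [h1, pShifted_apply p hm]
  refine measure_congr ((ae_bijective_shiftedSeq hp).mono fun s hs => propext ?_)
  exact forall_congr' fun l => imp_congr_right fun _ => imp_congr_right fun _ =>
    not_congr (isRenewal_shiftedPerm_iff hs l)

/-! ### Regeneration and full support of the p-shifted law -/

theorem measurableSet_forall_block_eq (n : ℕ) (b : ℕ → FinPerm) :
    MeasurableSet {σ | ∀ i < n, block i σ = b i} := by
  have : {σ | ∀ i < n, block i σ = b i} = ⋂ i, ⋂ (_ : i < n), block i ⁻¹' {b i} := by
    ext σ
    simp
  rw [this]
  exact MeasurableSet.iInter fun i => MeasurableSet.iInter fun _ =>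
    measurable_block i MeasurableSet.of_discrete

/-- The first renewal is at the size of `b`, and the terms before it are the entries of `b`. -/
def FirstBlock (b : FinPerm) : Set (ℕ → ℕ) :=
  {s | 0 < b.1 ∧ SeqRenewal s b.1 ∧ (∀ l, 0 < l → l < b.1 → ¬ SeqRenewal s l) ∧
    ∀ i < b.1, shiftedSeq s i = b.val i}

theorem firstBlock_initial (b : FinPerm) {s t : ℕ → ℕ} (hst : ∀ i < b.1, s i = t i)
    (hs : s ∈ FirstBlock b) : t ∈ FirstBlock b := by
  obtain ⟨h0, hr, hl, hv⟩ := hs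
  refine ⟨h0, hr.congr hst, fun l h1 h2 h => hl l h1 h2 (h.congr fun i hi => ?_), fun i hi => ?_⟩
  · exact (hst i (by omega)).symm
  · rw [← hv i hi]
    exact (shiftedSeq_congr i fun j hj => hst j (by omega)).symm

theorem block_zero_shiftedPerm_eq_iff {s : ℕ → ℕ} (hs : Function.Bijective (shiftedSeq s))
    (hi : {m | SeqRenewal s m}.Infinite) (b : FinPerm) :
    block 0 (shiftedPerm s) = b ↔ s ∈ FirstBlock b := by
  have hinf : {m | IsRenewal (shiftedPerm s) m}.Infinite := by
    simpa only [isRenewal_shiftedPerm_iff hs] using hi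
  rw [block_zero_eq_iff hinf]
  simp only [isRenewal_shiftedPerm_iff hs, shiftedPerm_apply hs]
  rfl

theorem block_succ_shiftedPerm {s : ℕ → ℕ} (hs : Function.Bijective (shiftedSeq s))
    (hi : {m | SeqRenewal s m}.Infinite) {b : FinPerm} (hb : s ∈ FirstBlock b) (k : ℕ) :
    block (k + 1) (shiftedPerm s) = block k (shiftedPerm (shift b.1 s)) := by
  have hinf : {m | IsRenewal (shiftedPerm s) m}.Infinite := by
    simpa only [isRenewal_shiftedPerm_iff hs] using hi
  have h1 : renewalTime 1 (shiftedPerm s) = b.1 := by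
    rw [← (block_zero_shiftedPerm_eq_iff hs hi b).2 hb]
    change _ = renewalTime 1 _ - renewalTime 0 _
    rw [renewalTime_zero, Nat.sub_zero]
  rw [(shiftedPerm_shift hs hb.2.1).2, ← h1, block_tail hinf]

/-- That the first block is `b 0` depends only on the first `(b 0).1` samples, and the later blocks
are those built from the remaining samples; independence splits off one factor per block. -/
theorem pShifted_forall_block_eq (hp : 0 < p 0)
    (hi : ∀ᵐ s ∂sampleLaw p, {m | SeqRenewal s m}.Infinite) (n : ℕ) (b : ℕ → FinPerm) :
    pShifted p {σ | ∀ i < n, block i σ = b i} =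
      ∏ i ∈ Finset.range n, (pShifted p).map (block 0) {b i} := by
  induction n generalizing b with
  | zero => simp
  | succ n ih =>
    have hb := ae_bijective_shiftedSeq hp
    have h0 : (pShifted p).map (block 0) {b 0} = sampleLaw p (FirstBlock (b 0)) := by
      rw [Measure.map_apply (measurable_block 0) (measurableSet_singleton _),
        pShifted_apply p (measurable_block 0 (measurableSet_singleton _))]
      refine measure_congr ?_
      filter_upwards [hb, hi] with s h1 h2
      exact propext (block_zero_shiftedPerm_eq_iff h1 h2 (b 0))
    rw [Finset.prod_range_succ', ← ih fun i => b (i + 1), h0,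
      pShifted_apply p (measurableSet_forall_block_eq _ _),
      pShifted_apply p (measurableSet_forall_block_eq _ _), mul_comm,
      ← sampleLaw_inter_shift p (b 0).1 (fun s t => firstBlock_initial (b 0))
        (measurable_shiftedPerm (measurableSet_forall_block_eq _ _))]
    refine measure_congr ?_
    filter_upwards [hb, hi] with s h1 h2
    refine propext ?_
    change (∀ i < n + 1, block i (shiftedPerm s) = b i) ↔ s ∈ FirstBlock (b 0) ∧
      ∀ i < n, block i (shiftedPerm (shift (b 0).1 s)) = b (i + 1)
    constructor
    · intro h
      have hF := (block_zero_shiftedPerm_eq_iff h1 h2 (b 0)).1 (h 0 n.succ_pos)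
      exact ⟨hF, fun i hi => by
        rw [← block_succ_shiftedPerm h1 h2 hF]
        exact h (i + 1) (by omega)⟩
    · rintro ⟨hF, h⟩ i hi
      rcases i with _ | i
      · exact (block_zero_shiftedPerm_eq_iff h1 h2 (b 0)).2 hF
      · rw [block_succ_shiftedPerm h1 h2 hF]
        exact h i (by omega)

theorem strictlyRegenerative_pShifted (hp : 0 < p 0)
    (hi : ∀ᵐ s ∂sampleLaw p, {m | SeqRenewal s m}.Infinite) :
    StrictlyRegenerative (pShifted p) := by
  have hprob := Measure.isProbabilityMeasure_map (μ := pShifted p)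
    (measurable_block 0).aemeasurable
  have hmap := map_eq_infinitePi measurable_block (fun _ => (pShifted p).map (block 0))
    (pShifted_forall_block_eq hp hi)
  obtain ⟨hind, hlaw⟩ := iIndepFun_of_map_eq_infinitePi measurable_block _ hmap
  have hid : ∀ k, IdentDistrib (block k) (block 0) (pShifted p) (pShifted p) := fun k =>
    ⟨(measurable_block k).aemeasurable, (measurable_block 0).aemeasurable, hlaw k⟩
  have hfst : Measurable fun b : FinPerm => b.1 := Measurable.of_discrete
  -- A gap is by definition the size of its block, so the gaps inherit the IID property.
  refine ⟨?_, ⟨hind.comp (fun _ (b : FinPerm) => b.1) fun _ => hfst, fun k => (hid k).comp hfst⟩,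
    hind, hid⟩
  refine (ae_pShifted_iff p ?_).2 ?_
  · have : {σ : SInf | {m : ℕ | IsRenewal σ m}.Infinite} =
        ⋂ a, ⋃ n, ⋃ (_ : a < n), {σ : SInf | IsRenewal σ n} := by
      ext σ
      simp only [Set.mem_ofPred_eq, Set.infinite_iff_exists_gt, Set.mem_iInter, Set.mem_iUnion,
        exists_prop]
      exact forall_congr' fun a => exists_congr fun n => and_comm
    rw [this]
    exact MeasurableSet.iInter fun a => MeasurableSet.iUnion fun n => MeasurableSet.iUnion fun _ =>
      measurableSet_isRenewal n
  · filter_upwards [ae_bijective_shiftedSeq hp, hi] with s h1 h2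
    simpa only [isRenewal_shiftedPerm_iff h1] using h2

/-- Prescribing the first `n` samples so that the word begins with `τ` forces a renewal at `n`,
where the projection merely reads off these entries. Such a cylinder has positive mass. -/
theorem pShifted_proj_pos (hp : ∀ k, 0 < p k) (n : ℕ) (τ : Equiv.Perm (Fin n)) :
    0 < pShifted p (proj n ⁻¹' {τ}) := by
  obtain ⟨w, hw⟩ := exists_shiftedSeq_eq (f := fun i => if h : i < n then (τ ⟨i, h⟩ : ℕ) else i) <| by
    intro i j hij
    simp only at hij
    split_ifs at hij with h1 h2 h2
    · simpa using τ.injective (Fin.ext hij)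
    · have := (τ ⟨i, h1⟩).isLt
      omega
    · have := (τ ⟨j, h2⟩).isLt
      omega
    · exact hij
  have hw' : ∀ i (hi : i < n), shiftedSeq w i = τ ⟨i, hi⟩ := fun i hi => by rw [hw, dif_pos hi]
  have hpos : 0 < sampleLaw p {s | ∀ i < n, s i = w i} := by
    rw [sampleLaw, infinitePi_initial, pos_iff_ne_zero, Finset.prod_ne_zero_iff]
    intro i _
    rw [PMF.toMeasure_apply_singleton _ _ (measurableSet_singleton _)]
    exact (hp _).ne'
  refine hpos.trans_le (le_trans (measure_mono_ae ?_)
    (Measure.le_map_apply measurable_shiftedPerm.aemeasurable _))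
  filter_upwards [ae_bijective_shiftedSeq (hp 0)] with s hs hsw
  have hsw' : ∀ i (hi : i < n), shiftedPerm s i = τ ⟨i, hi⟩ := fun i hi => by
    rw [shiftedPerm_apply hs, ← hw' i hi]
    exact shiftedSeq_congr i fun j hj => hsw j (by omega)
  have hr : IsRenewal (shiftedPerm s) n := isRenewal_iff.2 fun i hi => by
    rw [hsw' i hi]
    exact (τ _).isLt
  refine Equiv.ext fun i => Fin.ext ?_
  rw [proj_apply_of_isRenewal hr, hsw' i i.isLt]

/-! ### The joint law of the backward ranks -/

theorem prod_range_succ_skip {M : Type*} [CommMonoid M] (g : ℕ → M) {v n : ℕ} (hv : v ≤ n) :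
    ∏ j ∈ Finset.range (n + 1), g j = g v * ∏ j ∈ Finset.range n, g (skip v j) := by
  have h : Finset.range (n + 1) =
      insert v ((Finset.range n).map ⟨skip v, (strictMono_skip v).injective⟩) := by
    ext j
    simp only [Finset.mem_range, Finset.mem_insert, Finset.mem_map, Function.Embedding.coeFn_mk]
    constructor
    · intro hj
      by_cases hjv : j = v
      · exact Or.inl hjv
      · obtain ⟨x, rfl⟩ := exists_skip_eq hjv
        exact Or.inr ⟨x, (skip_lt_succ_iff hv).1 hj, rfl⟩
    · rintro (rfl | ⟨x, hx, rfl⟩)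
      · omega
      · exact (skip_lt_succ_iff hv).2 hx
  rw [h, Finset.prod_insert, Finset.prod_map]
  · rfl
  · simp [skip_ne]

/-- The weight `p_{i+1}` of the value `i` of the backward rank of `j`, which is at most `j`. -/
noncomputable def rankWeight (p : PMF ℕ) (j i : ℕ) : ENNReal := if i ≤ j then p i else 0

/-- When all `a j ≤ j`, only the largest `v ≤ n` with `a v = v` contributes. For a smaller fixed
point, `v` is relabelled `v - 1` and its rank `v` becomes too large. For `v` itself, every later `a
j` is below `j`, so lowering these indices changes no weight. -/
theorem sum_rankWeight (p : PMF ℕ) (n : ℕ) (a : ℕ → ℕ) (ha : a 0 = 0) :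
    ∑ v ∈ Finset.range (n + 1), (if a v = v then
      p v * ∏ j ∈ Finset.range n, rankWeight p j (a (skip v j)) else 0) =
    ∏ j ∈ Finset.range (n + 1), rankWeight p j (a j) := by
  classical
  by_cases hval : ∀ j ≤ n, a j ≤ j
  · set v := Nat.findGreatest (fun v => a v = v) n with hv
    have hvn : v ≤ n := Nat.findGreatest_le n
    have hav : a v = v := Nat.findGreatest_spec (P := fun v => a v = v) n.zero_le ha
    have hgt : ∀ j, v < j → j ≤ n → a j ≠ j := fun j h1 h2 =>
      Nat.findGreatest_is_greatest (P := fun v => a v = v) h1 h2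
    rw [Finset.sum_eq_single v, if_pos hav, prod_range_succ_skip _ hvn]
    · congr 1
      · rw [rankWeight, hav, if_pos le_rfl]
      · refine Finset.prod_congr rfl fun x hx => ?_
        rw [Finset.mem_range] at hx
        have hle : a (skip v x) ≤ skip v x := hval _ (by
          have := (skip_lt_succ_iff hvn).2 hx
          omega)
        rw [rankWeight, rankWeight, if_pos hle, if_pos]
        rcases lt_or_ge x v with h | h
        · rwa [skip_of_lt h] at hle ⊢
        · have := hgt (x + 1) (by omega) (by omega)
          rw [skip_of_le h] at hle ⊢
          omega
    · intro w hw hwv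
      rw [Finset.mem_range] at hw
      split_ifs with haw
      · have hlt : w < v := by
          by_contra h
          exact hgt w (by omega) (by omega) haw
        rw [Finset.prod_eq_zero (i := v - 1) (Finset.mem_range.2 (by omega)), mul_zero]
        rw [skip_of_le (by omega), Nat.sub_add_cancel (by omega), hav, rankWeight,
          if_neg (by omega)]
      · rfl
    · exact fun h => absurd (Finset.mem_range.2 (Nat.lt_succ_of_le hvn)) h
  -- If some `a j > j`, both sides vanish, as relabelling never raises an index.
  · push Not at hval
    obtain ⟨j, hj, haj⟩ := hval
    rw [Finset.prod_eq_zero (i := j) (Finset.mem_range.2 (by omega)),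
      Finset.sum_eq_zero]
    · intro v hv
      rw [Finset.mem_range] at hv
      split_ifs with hav
      · obtain ⟨x, rfl⟩ := exists_skip_eq (show j ≠ v by rintro rfl; omega)
        rw [Finset.prod_eq_zero (i := x)
          (Finset.mem_range.2 ((skip_lt_succ_iff (show v ≤ n by omega)).1 (by omega))), mul_zero]
        rw [rankWeight, if_neg]
        have : x ≤ skip v x := (strictMono_skip v).le_apply
        omega
      · rfl
    · rw [rankWeight, if_neg (by omega)]

theorem shiftedPerm_succ {s : ℕ → ℕ} (hs : Function.Bijective (shiftedSeq s)) :
    Function.Bijective (shiftedSeq (shift 1 s)) ∧ shiftedPerm s 0 = s 0 ∧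
      ∀ k, shiftedPerm s (k + 1) = skip (s 0) (shiftedPerm (shift 1 s) k) := by
  have hb : Function.Bijective (shiftedSeq (shift 1 s)) := by
    refine ⟨shiftedSeq_injective _, fun y => ?_⟩
    obtain ⟨k, hk⟩ := hs.2 (skip (s 0) y)
    rcases k with _ | k
    · rw [shiftedSeq_zero] at hk
      exact absurd hk.symm (skip_ne _ _)
    · rw [shiftedSeq_succ] at hk
      exact ⟨k, (strictMono_skip _).injective hk⟩
  refine ⟨hb, by rw [shiftedPerm_apply hs, shiftedSeq_zero], fun k => ?_⟩
  rw [shiftedPerm_apply hs, shiftedPerm_apply hb, shiftedSeq_succ]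

theorem measurableSet_forall_backwardRank_eq (n : ℕ) (a : ℕ → ℕ) :
    MeasurableSet {σ : SInf | ∀ j < n, backwardRank j σ = a j} := by
  have : {σ : SInf | ∀ j < n, backwardRank j σ = a j} =
      ⋂ j, ⋂ (_ : j < n), (fun σ => backwardRank j σ) ⁻¹' {a j} := by
    ext σ
    simp
  rw [this]
  exact MeasurableSet.iInter fun j => MeasurableSet.iInter fun _ =>
    measurable_backwardRank j MeasurableSet.of_discrete

/-- Samples whose permutation has prescribed backward ranks of the first `n` numbers. -/
def RankEvent (n : ℕ) (a : ℕ → ℕ) : Set (ℕ → ℕ) :=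
  shiftedPerm ⁻¹' {σ : SInf | ∀ j < n, backwardRank j σ = a j}

theorem measurableSet_rankEvent (n : ℕ) (a : ℕ → ℕ) : MeasurableSet (RankEvent n a) :=
  measurable_shiftedPerm (measurableSet_forall_backwardRank_eq n a)

/-- A first entry `v ≤ n` has rank `v`, and the other ranks are read off after relabelling. A first
entry above `n` leaves the numbers up to `n` unlabelled anew, so the same event recurs for the
shifted samples. -/
theorem mem_rankEvent_succ_iff {s : ℕ → ℕ} (hs : Function.Bijective (shiftedSeq s)) {n : ℕ}
    {a : ℕ → ℕ} : s ∈ RankEvent (n + 1) a ↔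
      if s 0 ≤ n then a (s 0) = s 0 ∧ shift 1 s ∈ RankEvent n (fun j => a (skip (s 0) j))
      else shift 1 s ∈ RankEvent (n + 1) a := by
  obtain ⟨-, h0, hk⟩ := shiftedPerm_succ hs
  have hskip := backwardRank_skip h0 hk
  have hfirst := backwardRank_first h0
  change (∀ j < n + 1, backwardRank j (shiftedPerm s) = a j) ↔ if s 0 ≤ n then a (s 0) = s 0 ∧
    ∀ j < n, backwardRank j (shiftedPerm (shift 1 s)) = a (skip (s 0) j) else
    ∀ j < n + 1, backwardRank j (shiftedPerm (shift 1 s)) = a j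
  split_ifs with hle
  · constructor
    · intro h
      refine ⟨?_, fun j hj => ?_⟩
      · rw [← h (s 0) (by omega), hfirst]
      · rw [← h _ ((skip_lt_succ_iff hle).2 hj), hskip]
    · rintro ⟨h1, h2⟩ j hj
      by_cases hjv : j = s 0
      · rw [hjv, hfirst, h1]
      · obtain ⟨x, rfl⟩ := exists_skip_eq hjv
        rw [hskip]
        exact h2 x ((skip_lt_succ_iff hle).1 hj)
  · refine forall₂_congr fun j hj => ?_
    rw [← hskip, skip_of_lt (by omega)]

theorem sampleLaw_rankEvent_succ (hp : 0 < p 0) (n : ℕ) (a : ℕ → ℕ) :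
    sampleLaw p (RankEvent (n + 1) a) =
      (∑ v ∈ Finset.range (n + 1), if a v = v then
        p v * sampleLaw p (RankEvent n fun j => a (skip v j)) else 0) +
      p.toMeasure {k | n < k} * sampleLaw p (RankEvent (n + 1) a) := by
  have hb := ae_bijective_shiftedSeq hp
  have hfirst : ∀ A : Set ℕ, MeasurableSet {s : ℕ → ℕ | s 0 ∈ A} := fun A =>
    measurable_pi_apply 0 MeasurableSet.of_discrete
  have hsplit : sampleLaw p (RankEvent (n + 1) a) =
      ∑ v ∈ Finset.range (n + 1), sampleLaw p (RankEvent (n + 1) a ∩ {s | s 0 ∈ ({v} : Set ℕ)}) +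
      sampleLaw p (RankEvent (n + 1) a ∩ {s | s 0 ∈ {k | n < k}}) := by
    rw [← measure_biUnion_finset, ← measure_union]
    · congr 1
      ext s
      simp only [Set.mem_union, Set.mem_iUnion, Set.mem_inter_iff, Set.mem_ofPred_eq,
        Set.mem_singleton_iff, Finset.mem_range, exists_prop]
      constructor
      · intro h
        rcases lt_or_ge n (s 0) with hn | hn
        · exact Or.inr ⟨h, hn⟩
        · exact Or.inl ⟨s 0, by omega, h, rfl⟩
      · rintro (⟨_, _, h, _⟩ | ⟨h, _⟩) <;> exact h
    · refine Set.disjoint_left.2 fun s hs1 hs2 => ?_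
      simp only [Set.mem_iUnion, Set.mem_inter_iff, Set.mem_ofPred_eq,
        Set.mem_singleton_iff, Finset.mem_range, exists_prop] at hs1 hs2
      obtain ⟨v, hv, -, hsv⟩ := hs1
      omega
    · exact (measurableSet_rankEvent _ _).inter (hfirst _)
    · intro v _ w _ hvw
      refine Set.disjoint_left.2 fun s hs1 hs2 => hvw ?_
      exact (show s 0 = v from hs1.2).symm.trans hs2.2
    · exact fun v _ => (measurableSet_rankEvent _ _).inter (hfirst _)
  have hind : ∀ (A : Set ℕ) {B : Set (ℕ → ℕ)}, MeasurableSet B →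
      sampleLaw p ({s | s 0 ∈ A} ∩ shift 1 ⁻¹' B) = p.toMeasure A * sampleLaw p B :=
    fun A B hB => by
      rw [sampleLaw_inter_shift p 1 (fun s t hst hs => ?_) hB, sampleLaw_first_mem]
      rw [Set.mem_ofPred_eq, ← hst 0 one_pos]
      exact hs
  conv_lhs => rw [hsplit]
  congr 1
  · refine Finset.sum_congr rfl fun v hv => ?_
    rw [Finset.mem_range] at hv
    split_ifs with hav
    · rw [← PMF.toMeasure_apply_singleton p v (measurableSet_singleton v),
        ← hind {v} (measurableSet_rankEvent _ _)]
      refine measure_congr ?_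
      filter_upwards [hb] with s hs
      refine propext ?_
      change s ∈ RankEvent (n + 1) a ∧ s 0 = v ↔ s 0 = v ∧ shift 1 s ∈ RankEvent n _
      rw [and_comm]
      refine and_congr_right fun hsv => ?_
      rw [mem_rankEvent_succ_iff hs, hsv, if_pos (by omega), and_iff_right hav]
    · rw [← measure_empty (μ := sampleLaw p)]
      refine measure_congr ?_
      filter_upwards [hb] with s hs
      refine propext ?_
      change s ∈ RankEvent (n + 1) a ∧ s 0 = v ↔ False
      rw [iff_false]
      rintro ⟨h, hsv⟩
      rw [mem_rankEvent_succ_iff hs, hsv, if_pos (by omega)] at h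
      exact hav h.1
  · rw [← hind _ (measurableSet_rankEvent _ _)]
    refine measure_congr ?_
    filter_upwards [hb] with s hs
    refine propext ?_
    change s ∈ RankEvent (n + 1) a ∧ n < s 0 ↔ n < s 0 ∧ shift 1 s ∈ RankEvent (n + 1) a
    rw [and_comm]
    refine and_congr_right fun hsv => ?_
    rw [mem_rankEvent_succ_iff hs, if_neg (by omega)]

/-- First-sample conditioning expresses the probability W as S + (1 - F_n) W. Since W is finite,
this gives F_n W = S, and `sum_rankWeight` evaluates S after the induction hypothesis. -/
theorem sampleLaw_rankEvent_mul (hp : 0 < p 0) (n : ℕ) (a : ℕ → ℕ) :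
    sampleLaw p (RankEvent n a) * ∏ j ∈ Finset.range n, cdfSum p j =
      ∏ j ∈ Finset.range n, rankWeight p j (a j) := by
  induction n generalizing a with
  | zero =>
    have : RankEvent 0 a = Set.univ := Set.eq_univ_of_forall fun s j hj =>
      absurd hj (Nat.not_lt_zero j)
    simp [this]
  | succ n ih =>
    by_cases ha : a 0 = 0
    · rw [← sum_rankWeight p n a ha]
      have h := sampleLaw_rankEvent_succ hp n a
      set W := sampleLaw p (RankEvent (n + 1) a) with hW
      have hWt : W ≠ ⊤ := measure_ne_top _ _
      have h2 : W * cdfSum p n = ∑ v ∈ Finset.range (n + 1), if a v = v then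
          p v * sampleLaw p (RankEvent n fun j => a (skip v j)) else 0 := by
        have h3 : W = W * cdfSum p n + p.toMeasure {k | n < k} * W := by
          rw [mul_comm W, ← add_mul, cdfSum_add, one_mul]
        have ht : p.toMeasure {k | n < k} * W ≠ ⊤ :=
          ENNReal.mul_ne_top (measure_ne_top _ _) hWt
        exact (ENNReal.add_left_inj ht).1 (h3.symm.trans h)
      rw [Finset.prod_range_succ, mul_comm (∏ j ∈ _, cdfSum p j), ← mul_assoc, h2,
        Finset.sum_mul]
      refine Finset.sum_congr rfl fun v _ => ?_
      split_ifs
      · rw [mul_assoc, ih]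
      · rw [zero_mul]
    · have h0 : RankEvent (n + 1) a = ∅ := Set.eq_empty_of_forall_notMem fun s hs => by
        have h1 : backwardRank 0 (shiftedPerm s) = a 0 := hs 0 n.succ_pos
        have := backwardRank_le 0 (shiftedPerm s)
        omega
      rw [h0, measure_empty, zero_mul, Finset.prod_eq_zero (i := 0) (Finset.mem_range.2 n.succ_pos)]
      rw [rankWeight, if_neg (by omega)]

/-- The law `p` conditioned on `{0, …, j}`. -/
noncomputable def truncLaw (p : PMF ℕ) (j : ℕ) : Measure ℕ := cond p.toMeasure {k | k < j + 1}

theorem isProbabilityMeasure_truncLaw (hp : ∀ k, 0 < p k) (j : ℕ) :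
    IsProbabilityMeasure (truncLaw p j) :=
  cond_isProbabilityMeasure (by rw [← cdfSum_eq]; exact cdfSum_ne_zero hp j)

theorem truncLaw_singleton (p : PMF ℕ) (j i : ℕ) :
    truncLaw p j {i} = (cdfSum p j)⁻¹ * rankWeight p j i := by
  rw [truncLaw, cond_apply MeasurableSet.of_discrete, ← cdfSum_eq, rankWeight]
  congr 1
  split_ifs with h
  · rw [← PMF.toMeasure_apply_singleton p i (measurableSet_singleton i)]
    congr 1
    ext k
    simp only [Set.mem_inter_iff, Set.mem_ofPred_eq, Set.mem_singleton_iff]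
    omega
  · rw [← measure_empty (μ := p.toMeasure)]
    congr 1
    refine Set.eq_empty_of_forall_notMem fun k hk => h ?_
    have h1 : k < j + 1 := hk.1
    have h2 : k = i := hk.2
    omega

theorem iIndepFun_backwardRank_pShifted (hp : ∀ k, 0 < p k) :
    iIndepFun (fun j σ => backwardRank j σ) (pShifted p) ∧
      ∀ j, (pShifted p).map (fun σ => backwardRank j σ) = truncLaw p j := by
  have := isProbabilityMeasure_truncLaw hp
  refine iIndepFun_of_map_eq_infinitePi measurable_backwardRank _
    (map_eq_infinitePi measurable_backwardRank (truncLaw p) fun n a => ?_)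
  rw [pShifted_apply p (measurableSet_forall_backwardRank_eq n a)]
  change sampleLaw p (RankEvent n a) = _
  simp_rw [truncLaw_singleton, Finset.prod_mul_distrib]
  rw [← sampleLaw_rankEvent_mul (hp 0), mul_comm, mul_assoc, ← Finset.prod_mul_distrib,
    Finset.prod_eq_one, mul_one]
  exact fun j _ => ENNReal.mul_inv_cancel (cdfSum_ne_zero hp j) (cdfSum_ne_top p j)

/-! ### Recovering p from the three conditions -/

variable {P : Measure SInf}

theorem measurableSet_backwardRank_eq (j i : ℕ) :
    MeasurableSet {σ : SInf | backwardRank j σ = i} :=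
  measurable_backwardRank j (measurableSet_singleton i)

/-- The permutation of a single number. -/
def FinPerm.unit : FinPerm := ⟨1, 1⟩

theorem isRenewal_one_iff_block {σ : SInf} (h : {m : ℕ | IsRenewal σ m}.Infinite) :
    IsRenewal σ 1 ↔ block 0 σ = FinPerm.unit := by
  rw [block_zero_eq_iff h]
  constructor
  · intro hr
    refine ⟨one_pos, hr, fun l h0 hl => ?_, fun i hi => ?_⟩
    · change l < 1 at hl
      omega
    · change i < 1 at hi
      obtain rfl : i = 0 := by omega
      rw [isRenewal_one_iff.1 hr]
      rfl
  · exact fun hr => hr.2.1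

theorem block_tail_one {σ : SInf} (h : {m : ℕ | IsRenewal σ m}.Infinite) (h1 : IsRenewal σ 1)
    (k : ℕ) : block k (tail σ 1) = block (k + 1) σ := by
  have hb : renewalTime 1 σ - renewalTime 0 σ = 1 :=
    congrArg Sigma.fst ((isRenewal_one_iff_block h).1 h1)
  rw [renewalTime_zero, Nat.sub_zero] at hb
  have := block_tail h k
  rwa [hb] at this

/-- Given a renewal at `1`, the backward rank of the number `j + 2` has the unconditional law of the
backward rank of `j + 1`. -/
theorem measure_isRenewal_one_inter [IsProbabilityMeasure P]
    (hinf : ∀ᵐ σ ∂P, {m : ℕ | IsRenewal σ m}.Infinite) (hiid : IID block P) (j i : ℕ) :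
    P ({σ | IsRenewal σ 1} ∩ {σ | backwardRank (j + 1) σ = i}) =
      P {σ | IsRenewal σ 1} * P {σ | backwardRank j σ = i} := by
  have hprob := Measure.isProbabilityMeasure_map (μ := P) (measurable_block 0).aemeasurable
  have hmap := hiid.1.map_fun_eq_infinitePi_map measurable_block
  simp_rw [fun k => (hiid.2 k).map_eq] at hmap
  have hBm : Measurable fun σ k => block k σ := measurable_pi_lambda _ measurable_block
  -- The rank of `j` expressed through the first `j + 1` blocks, so that the IID property of the
  -- block sequence applies.
  let D : Set (ℕ → FinPerm) := {x | ∃ τ : SInf, {m : ℕ | IsRenewal τ m}.Infinite ∧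
    (∀ k < j + 1, block k τ = x k) ∧ backwardRank j τ = i}
  have hD : MeasurableSet D := measurableSet_of_initial (j + 1) fun s t hst ⟨τ, h1, h2, h3⟩ =>
    ⟨τ, h1, fun k hk => (h2 k hk).trans (hst k hk), h3⟩
  have hmem : ∀ σ : SInf, {m : ℕ | IsRenewal σ m}.Infinite →
      (backwardRank j σ = i ↔ (fun k => block k σ) ∈ D) := fun σ hσ =>
    ⟨fun h => ⟨σ, hσ, fun _ _ => rfl, h⟩, fun ⟨τ, h1, h2, h3⟩ =>
      (backwardRank_eq_of_block_eq hσ h1 fun k hk => (h2 k hk).symm).trans h3⟩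
  have hfirst : MeasurableSet {x : ℕ → FinPerm | x 0 = FinPerm.unit} :=
    measurable_pi_apply 0 (measurableSet_singleton _)
  have e1 : P {σ | backwardRank j σ = i} = P.map (fun σ k => block k σ) D := by
    rw [Measure.map_apply hBm hD]
    exact measure_congr (hinf.mono fun σ hσ => propext (hmem σ hσ))
  have e2 : P {σ | IsRenewal σ 1} = P.map (block 0) {FinPerm.unit} := by
    rw [Measure.map_apply (measurable_block 0) (measurableSet_singleton _)]
    exact measure_congr (hinf.mono fun σ hσ => propext (isRenewal_one_iff_block hσ))
  have e3 : P ({σ | IsRenewal σ 1} ∩ {σ | backwardRank (j + 1) σ = i}) =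
      P.map (fun σ k => block k σ) ({x | x 0 = FinPerm.unit} ∩ shift 1 ⁻¹' D) := by
    rw [Measure.map_apply hBm (hfirst.inter (measurable_shift 1 hD))]
    refine measure_congr (hinf.mono fun σ hσ => propext ?_)
    change IsRenewal σ 1 ∧ backwardRank (j + 1) σ = i ↔
      block 0 σ = FinPerm.unit ∧ shift 1 (fun k => block k σ) ∈ D
    rw [← isRenewal_one_iff_block hσ]
    refine and_congr_right fun h1 => ?_
    rw [← backwardRank_tail_one h1, hmem _ ((infinite_isRenewal_tail_iff h1).2 hσ)]
    have : (fun k => block k (tail σ 1)) = shift 1 fun k => block k σ := funext fun k => by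
      rw [block_tail_one hσ h1, shift, add_comm]
    rw [this]
  rw [e1, e2, e3, hmap]
  exact infinitePi_first_inter_shift _ _ hD

theorem setOf_isRenewal_one_eq : {σ : SInf | IsRenewal σ 1} =
    ⋂ l, {σ : SInf | backwardRank (l + 1) σ ≠ l + 1} := by
  ext σ
  simp [isRenewal_one_iff_backwardRank]

/-- Splitting off one factor in the intersection of independent events that is a renewal at `1`. -/
theorem exists_measure_factor (hI : iIndepFun (fun j σ => backwardRank (j + 1) σ) P) (j : ℕ) :
    ∃ r, P {σ | IsRenewal σ 1} = P {σ | backwardRank (j + 1) σ ≠ j + 1} * r ∧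
      ∀ i, i ≠ j + 1 → P ({σ | IsRenewal σ 1} ∩ {σ | backwardRank (j + 1) σ = i}) =
        P {σ | backwardRank (j + 1) σ = i} * r := by
  have hind := indep_biSup_compl
    (fun l => (measurable_backwardRank (l + 1)).comap_le) hI {j}
  rw [Indep_iff] at hind
  -- The renewal at `1` with its condition on the rank of `j + 1` dropped; its probability is the
  -- factor `r`.
  let R : Set SInf := ⋂ l, ⋂ (_ : l ≠ j), {σ : SInf | backwardRank (l + 1) σ ≠ l + 1}
  have hS : ∀ A : Set ℕ, MeasurableSet[⨆ n ∈ ({j} : Set ℕ), MeasurableSpace.comap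
      (fun σ : SInf => backwardRank (n + 1) σ) inferInstance]
      {σ : SInf | backwardRank (j + 1) σ ∈ A} := fun A =>
    le_iSup₂_of_le (f := fun n (_ : n ∈ ({j} : Set ℕ)) => MeasurableSpace.comap
      (fun σ : SInf => backwardRank (n + 1) σ) inferInstance) j rfl le_rfl _
      ⟨A, MeasurableSet.of_discrete, rfl⟩
  have hT : MeasurableSet[⨆ n ∈ ({j} : Set ℕ)ᶜ, MeasurableSpace.comap
      (fun σ : SInf => backwardRank (n + 1) σ) inferInstance] R := by
    refine MeasurableSet.iInter fun l => MeasurableSet.iInter fun hl => ?_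
    exact le_iSup₂_of_le (f := fun n (_ : n ∈ ({j} : Set ℕ)ᶜ) => MeasurableSpace.comap
      (fun σ : SInf => backwardRank (n + 1) σ) inferInstance) l hl le_rfl _
      ⟨{l + 1}ᶜ, MeasurableSet.of_discrete, rfl⟩
  refine ⟨P R, ?_, fun i hi => ?_⟩
  · refine Eq.trans ?_ (hind _ R (hS {j + 1}ᶜ) hT)
    rw [setOf_isRenewal_one_eq]
    congr 1
    ext σ
    simp only [Set.mem_iInter, Set.mem_inter_iff, R]
    exact ⟨fun h => ⟨h j, fun l _ => h l⟩, fun h l => by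
      by_cases hl : l = j
      · rw [hl]
        exact h.1
      · exact h.2 l hl⟩
  · refine Eq.trans ?_ (hind _ R (hS {i}) hT)
    rw [setOf_isRenewal_one_eq]
    congr 1
    ext σ
    simp only [Set.mem_iInter, Set.mem_inter_iff, R]
    constructor
    · exact fun h => ⟨h.2, fun l _ => h.1 l⟩
    · rintro ⟨h1, h2⟩
      refine ⟨fun l => ?_, h1⟩
      by_cases hl : l = j
      · rw [hl]
        have : backwardRank (j + 1) σ = i := h1
        rw [Set.mem_ofPred_eq, this]
        exact hi
      · exact h2 l hl

/-- The joint probability of a renewal at `1` and rank `i` of `j + 1` has two forms. Independence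
splits off the common factor `r`, regeneration gives u_1 · P(I_j = i), and u_1 contains `r` too;
cancel it. -/
theorem measure_backwardRank_succ [IsProbabilityMeasure P]
    (hI : iIndepFun (fun j σ => backwardRank (j + 1) σ) P)
    (hinf : ∀ᵐ σ ∂P, {m : ℕ | IsRenewal σ m}.Infinite) (hiid : IID block P)
    (hu : P {σ | IsRenewal σ 1} ≠ 0) {j i : ℕ} (hij : i ≤ j) :
    P {σ | backwardRank (j + 1) σ = i} =
      P {σ | backwardRank (j + 1) σ ≠ j + 1} * P {σ | backwardRank j σ = i} := by
  obtain ⟨r, h1, h2⟩ := exists_measure_factor hI j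
  have hr0 : r ≠ 0 := by
    rintro rfl
    rw [mul_zero] at h1
    exact hu h1
  have h0 : P {σ | backwardRank (j + 1) σ ≠ j + 1} ≠ 0 := fun h => by
    rw [h, zero_mul] at h1
    exact hu h1
  have hrt : r ≠ ⊤ := by
    rintro rfl
    rw [ENNReal.mul_top h0] at h1
    exact measure_ne_top _ _ h1
  have h3 := h2 i (by omega)
  rw [measure_isRenewal_one_inter hinf hiid, h1, mul_right_comm] at h3
  exact ((ENNReal.mul_left_inj hr0 hrt).1 h3).symm

theorem tendsto_prod_measure_backwardRank_ne [IsProbabilityMeasure P]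
    (hI : iIndepFun (fun j σ => backwardRank (j + 1) σ) P) :
    Filter.Tendsto (fun n => ∏ l ∈ Finset.range n, P {σ | backwardRank (l + 1) σ ≠ l + 1})
      Filter.atTop (nhds (P {σ | IsRenewal σ 1})) := by
  have hm : ∀ l, MeasurableSet {σ : SInf | backwardRank (l + 1) σ ≠ l + 1} := fun l =>
    (measurableSet_backwardRank_eq (l + 1) (l + 1)).compl
  have hprod : ∀ n, ∏ l ∈ Finset.range n, P {σ | backwardRank (l + 1) σ ≠ l + 1} =
      P (⋂ l ∈ Finset.range n, {σ : SInf | backwardRank (l + 1) σ ≠ l + 1}) := fun n =>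
    (hI.measure_inter_preimage_eq_mul (Finset.range n) (sets := fun l => {l + 1}ᶜ)
      fun l _ => MeasurableSet.of_discrete).symm
  simp_rw [hprod]
  have hset : {σ : SInf | IsRenewal σ 1} =
      ⋂ n, ⋂ l ∈ Finset.range n, {σ : SInf | backwardRank (l + 1) σ ≠ l + 1} := by
    rw [setOf_isRenewal_one_eq]
    ext σ
    simp only [Set.mem_iInter, Finset.mem_range]
    exact ⟨fun h n l _ => h l, fun h l => h (l + 1) l (by omega)⟩
  rw [hset]
  refine tendsto_measure_iInter_atTop (fun n => ?_) (fun m n hmn => ?_) ⟨0, measure_ne_top _ _⟩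
  · exact ((Finset.range n).measurableSet_biInter fun l _ => hm l).nullMeasurableSet
  · exact Set.biInter_subset_biInter_left fun l hl => Finset.range_mono hmn hl

theorem pShifted_eq_of_map_backwardRank {p : PMF ℕ} (hp : ∀ k, 0 < p k)
    (hI : iIndepFun (fun j σ => backwardRank (j + 1) σ) P)
    (h : ∀ j, P.map (fun σ => backwardRank (j + 1) σ) = truncLaw p (j + 1)) :
    P = pShifted p := by
  have hm : ∀ j, Measurable fun σ : SInf => backwardRank (j + 1) σ := fun j =>
    measurable_backwardRank (j + 1)
  obtain ⟨hQ, hQm⟩ := iIndepFun_backwardRank_pShifted hp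
  have hQs : iIndepFun (fun j σ => backwardRank (j + 1) σ) (pShifted p) :=
    hQ.precomp Nat.succ_injective
  have hQsm : ∀ j, (pShifted p).map (fun σ => backwardRank (j + 1) σ) = truncLaw p (j + 1) :=
    fun j => hQm (j + 1)
  have h1 := hI.map_fun_eq_infinitePi_map hm
  have h2 := hQs.map_fun_eq_infinitePi_map hm
  simp_rw [h] at h1
  simp_rw [hQsm] at h2
  -- The hypotheses concern ranks from index `1` on; `e` restores the rank of `0`, which is always
  -- `0`.
  let e : (ℕ → ℕ) → ℕ → ℕ := fun f j => if j = 0 then 0 else f (j - 1)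
  have he : Measurable e := measurable_pi_lambda _ fun j => by
    by_cases hj : j = 0
    · simp [e, hj]
    · simpa [e, hj] using measurable_pi_apply (j - 1)
  have hcomp : (fun (σ : SInf) (j : ℕ) => backwardRank j σ) =
      e ∘ fun (σ : SInf) (j : ℕ) => backwardRank (j + 1) σ := by
    ext σ j
    rcases j with _ | j
    · simpa [e] using backwardRank_le 0 σ
    · simp [e]
  refine measure_ext_of_map_backwardRank ?_
  rw [hcomp, ← Measure.map_map he (measurable_pi_lambda _ hm),
    ← Measure.map_map he (measurable_pi_lambda _ hm)]
  exact congrArg _ (h1.trans h2.symm)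

theorem measure_backwardRank_self_pos
    (h : ∀ (n : ℕ) (τ : Equiv.Perm (Fin n)), 0 < P (proj n ⁻¹' {τ})) (n : ℕ) :
    0 < P {σ | backwardRank n σ = n} := by
  -- Any permutation with its largest entry first would serve; the swap is one.
  refine (h (n + 1) (Equiv.swap 0 (Fin.last n))).trans_le (measure_mono fun σ hσ => ?_)
  refine backwardRank_of_proj_zero ?_
  rw [show proj (n + 1) σ = Equiv.swap 0 (Fin.last n) from hσ, Equiv.swap_apply_left]

/-- A family of weights with the recursion satisfied by the laws of the backward ranks comes from
the truncations of a single distribution. -/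
theorem exists_pmf_of_recursion {q : ℕ → ℕ → ENNReal} {e : ℕ → ENNReal} {u : ENNReal}
    (hu : u ≠ 0) (he : ∀ j, e j + q (j + 1) (j + 1) = 1) (h00 : q 0 0 = 1)
    (hpos : ∀ j, q j j ≠ 0) (hrec : ∀ j i, i ≤ j → q (j + 1) i = e j * q j i)
    (hlim : Filter.Tendsto (fun n => ∏ l ∈ Finset.range n, e l) Filter.atTop (nhds u)) :
    ∃ p : PMF ℕ, (∀ k, 0 < p k) ∧ ∀ j i, i ≤ j → q j i = (cdfSum p j)⁻¹ * p i := by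
  set D : ℕ → ENNReal := fun n => ∏ l ∈ Finset.range n, e l with hD
  have hDs : ∀ n, D (n + 1) = D n * e n := fun n => Finset.prod_range_succ _ _
  have hanti : Antitone D := antitone_prod_of_add_eq_one he
  have huD : ∀ n, u ≤ D n := fun n => hanti.le_of_tendsto hlim n
  have hD0 : ∀ n, D n ≠ 0 := fun n h => hu (le_antisymm (h ▸ huD n) zero_le)
  have hDt : ∀ n, D n ≠ ⊤ := fun n => ENNReal.prod_ne_top fun l _ =>
    ne_top_of_le_ne_top ENNReal.one_ne_top (le_one_of_add_eq_one he l)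
  have hut : u ≠ ⊤ := ne_top_of_le_ne_top (hDt 0) (huD 0)
  -- If `q` comes from truncating p, then e_l = F_l / F_{l+1} and u = F_0, so F_i = u / D_i and p_i
  -- = F_i q_i(i). This forces the formula.
  let f : ℕ → ENNReal := fun i => u * (q i i * (D i)⁻¹)
  -- The partial sums telescope to u / D_n, which tends to 1 because D_n tends to u > 0.
  have hsum : ∀ n, ∑ i ∈ Finset.range (n + 1), f i = u * (D n)⁻¹ := fun n => by
    induction n with
    | zero => simp [f, hD, h00]
    | succ n ih =>
      have hinv : (D n)⁻¹ = e n * (D (n + 1))⁻¹ := by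
        refine (ENNReal.mul_left_inj (hD0 (n + 1)) (hDt (n + 1))).1 ?_
        rw [mul_assoc, ENNReal.inv_mul_cancel (hD0 _) (hDt _), mul_one, hDs, ← mul_assoc,
          ENNReal.inv_mul_cancel (hD0 _) (hDt _), one_mul]
      rw [Finset.sum_range_succ, ih, hinv, ← mul_add, ← add_mul, he, one_mul]
  have htsum : HasSum f 1 := by
    rw [ENNReal.summable.hasSum_iff_tendsto_nat, ← Filter.tendsto_add_atTop_iff_nat 1]
    simp_rw [hsum]
    have := ENNReal.Tendsto.const_mul (a := u) (tendsto_inv_iff.2 hlim) (Or.inr hut)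
    rwa [ENNReal.mul_inv_cancel hu hut] at this
  -- By the recursion, q_j(i) / D_j does not depend on j ≥ i.
  have hq : ∀ j i, i ≤ j → q j i * D i = q i i * D j := fun j i hij => by
    induction j, hij using Nat.le_induction with
    | base => rfl
    | succ j hij ih => rw [hrec j i hij, hDs, mul_assoc, ih]; ring
  refine ⟨⟨f, htsum⟩, fun k => ?_, fun j i hij => ?_⟩
  · exact ENNReal.mul_pos hu (mul_ne_zero (hpos k) (ENNReal.inv_ne_zero.2 (hDt k)))
  · have hF : cdfSum ⟨f, htsum⟩ j = u * (D j)⁻¹ := hsum j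
    rw [hF]
    change _ = _ * (u * (q i i * (D i)⁻¹))
    rw [ENNReal.mul_inv (Or.inl hu) (Or.inl hut), inv_inv, mul_comm u⁻¹, mul_assoc,
      ← mul_assoc u⁻¹, ENNReal.inv_mul_cancel hu hut, one_mul, ← mul_assoc, mul_comm (D j),
      ← hq j i hij, mul_assoc, ENNReal.mul_inv_cancel (hD0 i) (hDt i), mul_one]

theorem exists_eq_pShifted [IsProbabilityMeasure P]
    (hI : iIndepFun (fun j σ => backwardRank (j + 1) σ) P) (hreg : StrictlyRegenerative P)
    (hu : 0 < renewalProb P 1)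
    (hsupp : ∀ (n : ℕ) (τ : Equiv.Perm (Fin n)), 0 < P (proj n ⁻¹' {τ})) :
    ∃ p : PMF ℕ, (∀ k, 0 < p k) ∧ P = pShifted p := by
  have hu' : P {σ | IsRenewal σ 1} ≠ 0 := hu.ne'
  obtain ⟨p, hp, hq⟩ := exists_pmf_of_recursion (q := fun j i => P {σ | backwardRank j σ = i})
    (e := fun j => P {σ | backwardRank (j + 1) σ ≠ j + 1}) hu'
    (fun j => by
      rw [add_comm, ← measure_univ (μ := P)]
      exact measure_add_measure_compl (measurableSet_backwardRank_eq (j + 1) (j + 1)))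
    (by
      rw [← measure_univ (μ := P)]
      congr 1
      exact Set.eq_univ_of_forall fun σ => Nat.le_zero.1 (backwardRank_le 0 σ))
    (fun j => (measure_backwardRank_self_pos hsupp j).ne')
    (fun j i hij => measure_backwardRank_succ hI hreg.1 hreg.2.2 hu' hij)
    (tendsto_prod_measure_backwardRank_ne hI)
  refine ⟨p, hp, pShifted_eq_of_map_backwardRank hp hI fun j => ?_⟩
  refine Measure.ext_of_singleton fun i => ?_
  rw [Measure.map_apply (measurable_backwardRank _) (measurableSet_singleton i),
    truncLaw_singleton, rankWeight]
  split_ifs with h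
  · exact hq _ _ h
  · rw [mul_zero, ← measure_empty (μ := P)]
    congr 1
    refine Set.eq_empty_of_forall_notMem fun σ (hσ : backwardRank (j + 1) σ = i) => ?_
    have := backwardRank_le (j + 1) σ
    omega

end PShifted

/-! ### The characterization -/

theorem proposition3 :
    {P : Measure PShifted.SInf | ∃ p : PMF ℕ,
        (∀ k, 0 < p k) ∧ ∑' k : ℕ, ((k : ENNReal) + 1) * p k < ⊤ ∧ P = PShifted.pShifted p} =
    {P : Measure PShifted.SInf | IsProbabilityMeasure P ∧
        iIndepFun (fun (j : ℕ) (σ : PShifted.SInf) => PShifted.backwardRank (j + 1) σ) P ∧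
        (PShifted.StrictlyRegenerative P ∧ PShifted.PositiveRecurrent P ∧
          0 < PShifted.renewalProb P 1) ∧
        ∀ (n : ℕ) (τ : Equiv.Perm (Fin n)), 0 < P (PShifted.proj n ⁻¹' {τ})} := by
  open PShifted in
  ext P
  constructor
  · rintro ⟨p, hp, hmean, rfl⟩
    have hsum := (tsum_add_one_mul_lt_top_iff hp).1 hmean
    have hreg := strictlyRegenerative_pShifted (hp 0) (ae_infinite_seqRenewal hsum)
    refine ⟨inferInstance,
      (iIndepFun_backwardRank_pShifted hp).1.precomp Nat.succ_injective, ⟨hreg, ?_, ?_⟩,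
      pShifted_proj_pos hp⟩
    · rw [PositiveRecurrent, lintegral_renewalTime_one (hp 0) hreg.1]
      exact hsum
    · have h : renewalProb (pShifted p) 1 = sampleLaw p {s | SeqRenewal s 1} := by
        rw [renewalProb, pShifted_apply p (measurableSet_isRenewal 1)]
        exact measure_congr ((ae_bijective_shiftedSeq (hp 0)).mono fun s hs =>
          propext (isRenewal_shiftedPerm_iff hs 1))
      rw [h, sampleLaw_seqRenewal, Finset.prod_range_one]
      exact pos_iff_ne_zero.2 (cdfSum_ne_zero hp 0)
  · rintro ⟨hP, hI, ⟨hreg, hpr, hu⟩, hsupp⟩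
    obtain ⟨p, hp, rfl⟩ := exists_eq_pShifted hI hreg hu hsupp
    refine ⟨p, hp, (tsum_add_one_mul_lt_top_iff hp).2 ?_, rfl⟩
    rw [← lintegral_renewalTime_one (hp 0) hreg.1]
    exact hpr
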